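/- Let $N\ge 2$ and let the loop of length $2\pi$ be the interval $I=(0,2\pi)$ with periodic boundary conditions, equivalently $\mathbb R/2\pi\mathbb Z$ with its arc-length distance. For $\alpha\in\mathbb R$ and an $N$-point set $Y\subset(0,2\pi)$ let $H_{\alpha,Y}=-\frac{d^2}{dx^2}+\alpha\sum_{y\in Y}\delta(x-y)$ be the self-adjoint operator in $L^2(I)$ associated with the quadratic form $$q_{\alpha,Y}(\psi)=\|\psi'\|^2+\alpha\sum_{y\in Y}|\psi(y)|^2,\qquad \psi\in H^1(I),\ \psi(0)=\psi(2\pi),$$ and let $\lambda_1(\alpha,Y)$ be its lowest eigenvalue. Let $\tilde Y=\{\frac{\pi}{N}(2j-1): j=1,\dots,N\}$ be the equidistant set. Call $Y$ and $\tilde Y$ congruent if an isometry of the loop maps $Y$ onto $\tilde Y$. Theorem. There is $\alpha_0=\alpha_0(N)>0$ such that for every real $\alpha$ with $|\alpha|<\alpha_0$ and every $N$-point set $Y\subset(0,2\pi)$ the lowest eigenvalues $\lambda_1(\alpha,Y)$ and $\lambda_1(\alpha,\tilde Y)$ exist and $$\lambda_1(\alpha,Y)\le\lambda_1(\alpha,\tilde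 Y);$$ moreover, if $\alpha\ne0$, the inequality is strict if and only if $Y$ is not congruent to $\tilde Y$. -/

import Mathlib

open MeasureTheory Set

open scoped ComplexConjugate

noncomputable section

namespace LoopDelta

/-- Lebesgue measure on the interval `I = (0, 2π)`. -/
abbrev loopMeasure : Measure ℝ := volume.restrict (Ioo 0 (2 * Real.pi))

/-- The Hilbert space `L²(I)` of complex-valued functions. -/
abbrev L2 : Type := Lp ℂ 2 loopMeasure

/-- `ψ` is (the absolutely continuous representative of) a periodic function from `H¹(I)` and
`dψ ∈ L²(I)` is its weak derivative: `ψ` is the primitive of `dψ` on `[0, 2π]`, and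
`ψ(2π) = ψ(0)`. The values of `ψ` outside `[0, 2π]` play no role. -/
structure IsPeriodicH1 (ψ dψ : ℝ → ℂ) : Prop where
  memLp_deriv : MemLp dψ 2 loopMeasure
  eq_primitive : ∀ x ∈ Icc 0 (2 * Real.pi), ψ x = ψ 0 + ∫ t in (0 : ℝ)..x, dψ t
  periodic : ψ (2 * Real.pi) = ψ 0

/-- The sesquilinear form `q_{α,Y}(φ, ψ) = (φ', ψ') + α ∑_{y ∈ Y} conj φ(y) ψ(y)`, linear in
the second argument; its diagonal is `‖ψ'‖² + α ∑_{y ∈ Y} |ψ(y)|²`. -/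
def form (α : ℝ) (Y : Finset ℝ) (φ dφ ψ dψ : ℝ → ℂ) : ℂ :=
  (∫ x in Ioo 0 (2 * Real.pi), conj (dφ x) * dψ x) + (α : ℂ) * ∑ y ∈ Y, conj (φ y) * ψ y

theorem IsPeriodicH1.zero : IsPeriodicH1 0 0 :=
  ⟨MemLp.zero, by simp, by simp⟩

theorem IsPeriodicH1.intervalIntegrable {ψ dψ : ℝ → ℂ} (h : IsPeriodicH1 ψ dψ) :
    IntervalIntegrable dψ volume 0 (2 * Real.pi) := by
  rw [intervalIntegrable_iff_integrableOn_Ioo_of_le (by positivity)]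
  exact h.memLp_deriv.integrable (by norm_num)

theorem IsPeriodicH1.continuousOn {ψ dψ : ℝ → ℂ} (h : IsPeriodicH1 ψ dψ) :
    ContinuousOn ψ (Icc 0 (2 * Real.pi)) := by
  have h0 : (0 : ℝ) ≤ 2 * Real.pi := by positivity
  have h1 : ContinuousOn (fun x => ψ 0 + ∫ t in (0 : ℝ)..x, dψ t) (Icc 0 (2 * Real.pi)) := by
    have := intervalIntegral.continuousOn_primitive_interval'
      h.intervalIntegrable (a := 0) (by simp [h0])
    rw [uIcc_of_le h0] at this
    exact continuousOn_const.add this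
  exact h1.congr h.eq_primitive

theorem IsPeriodicH1.memLp {ψ dψ : ℝ → ℂ} (h : IsPeriodicH1 ψ dψ) : MemLp ψ 2 loopMeasure := by
  obtain ⟨C, hC⟩ := isCompact_Icc.exists_bound_of_continuousOn h.continuousOn
  refine MemLp.of_bound
    ((h.continuousOn.mono Ioo_subset_Icc_self).aestronglyMeasurable measurableSet_Ioo) C ?_
  exact (ae_restrict_mem measurableSet_Ioo).mono fun x hx => hC x (Ioo_subset_Icc_self hx)

theorem IsPeriodicH1.add {ψ dψ χ dχ : ℝ → ℂ} (h : IsPeriodicH1 ψ dψ) (k : IsPeriodicH1 χ dχ) :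
    IsPeriodicH1 (ψ + χ) (dψ + dχ) := by
  refine ⟨h.memLp_deriv.add k.memLp_deriv, fun x hx => ?_, ?_⟩
  · have hs : uIcc 0 x ⊆ uIcc 0 (2 * Real.pi) := by
      rw [uIcc_of_le hx.1, uIcc_of_le (hx.1.trans hx.2)]
      exact Icc_subset_Icc_right hx.2
    simp only [Pi.add_apply]
    rw [h.eq_primitive x hx, k.eq_primitive x hx, intervalIntegral.integral_add
      (h.intervalIntegrable.mono_set hs) (k.intervalIntegrable.mono_set hs)]
    ring
  · simp only [Pi.add_apply, h.periodic, k.periodic]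

theorem IsPeriodicH1.smul {ψ dψ : ℝ → ℂ} (h : IsPeriodicH1 ψ dψ) (c : ℂ) :
    IsPeriodicH1 (c • ψ) (c • dψ) := by
  refine ⟨h.memLp_deriv.const_smul c, fun x hx => ?_, ?_⟩
  · simp only [Pi.smul_apply, intervalIntegral.integral_smul, h.eq_primitive x hx, smul_add]
  · simp only [Pi.smul_apply, h.periodic]

theorem integrable_conj_mul {f g : ℝ → ℂ} (hf : MemLp f 2 loopMeasure)
    (hg : MemLp g 2 loopMeasure) : Integrable (fun x => conj (f x) * g x) loopMeasure :=
  hf.star.integrable_mul hg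

/-- The graph of the operator associated with the form `q_{α,Y}`: the pair `(u, f)` belongs to it
iff `u` is in the form domain and `q_{α,Y}(φ, u) = (φ, f)` for all `φ` in the form domain. -/
def graph (α : ℝ) (Y : Finset ℝ) : Submodule ℂ (L2 × L2) where
  carrier := {p | ∃ ψ dψ : ℝ → ℂ, IsPeriodicH1 ψ dψ ∧ p.1 =ᵐ[loopMeasure] ψ ∧
    ∀ φ dφ : ℝ → ℂ, IsPeriodicH1 φ dφ →
      form α Y φ dφ ψ dψ = ∫ x in Ioo 0 (2 * Real.pi), conj (φ x) * p.2 x}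
  zero_mem' := by
    refine ⟨0, 0, IsPeriodicH1.zero, Lp.coeFn_zero _ _ _, fun φ dφ _ => ?_⟩
    have : (fun x => conj (φ x) * (0 : L2) x) =ᵐ[loopMeasure] fun _ => 0 := by
      filter_upwards [Lp.coeFn_zero ℂ 2 loopMeasure] with x hx
      rw [hx, Pi.zero_apply, mul_zero]
    rw [show ((0 : L2 × L2).2) = 0 from rfl, integral_congr_ae this]
    simp [form]
  add_mem' := by
    rintro ⟨u, f⟩ ⟨v, g⟩ ⟨ψ, dψ, h, hu, hf⟩ ⟨χ, dχ, k, hv, hg⟩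
    refine ⟨ψ + χ, dψ + dχ, h.add k, (Lp.coeFn_add u v).trans (hu.add hv), fun φ dφ hφ => ?_⟩
    have e : (fun x => conj (φ x) * (f + g : L2) x) =ᵐ[loopMeasure]
        fun x => conj (φ x) * f x + conj (φ x) * g x := by
      filter_upwards [Lp.coeFn_add f g] with x hx
      rw [hx, Pi.add_apply, mul_add]
    rw [show (((u, f) + (v, g) : L2 × L2).2) = f + g from rfl, integral_congr_ae e,
      integral_add (integrable_conj_mul hφ.memLp (Lp.memLp f))
        (integrable_conj_mul hφ.memLp (Lp.memLp g)), ← hf φ dφ hφ, ← hg φ dφ hφ]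
    simp only [form, Pi.add_apply, mul_add, Finset.sum_add_distrib]
    rw [integral_add (integrable_conj_mul hφ.memLp_deriv h.memLp_deriv)
      (integrable_conj_mul hφ.memLp_deriv k.memLp_deriv)]
    ring
  smul_mem' := by
    rintro c ⟨u, f⟩ ⟨ψ, dψ, h, hu, hf⟩
    refine ⟨c • ψ, c • dψ, h.smul c, (Lp.coeFn_smul c u).trans (hu.const_smul c),
      fun φ dφ hφ => ?_⟩
    have e : (fun x => conj (φ x) * (c • f : L2) x) =ᵐ[loopMeasure]
        fun x => c * (conj (φ x) * f x) := by
      filter_upwards [Lp.coeFn_smul c f] with x hx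
      simp only [hx, Pi.smul_apply, smul_eq_mul]
      ring
    rw [show ((c • (u, f) : L2 × L2).2) = c • f from rfl, integral_congr_ae e,
      integral_const_mul, ← hf φ dφ hφ]
    simp only [form, Pi.smul_apply, smul_eq_mul, mul_left_comm _ c, integral_const_mul,
      ← Finset.mul_sum]
    ring

/-- A smooth function with compact support in `I` is a periodic function from `H¹(I)`. -/
theorem isPeriodicH1_of_contDiff {g : ℝ → ℝ} (hg : ContDiff ℝ 1 g)
    (hs : tsupport g ⊆ Ioo 0 (2 * Real.pi)) :
    IsPeriodicH1 (fun x => (g x : ℂ)) (fun x => ((deriv g x : ℝ) : ℂ)) := by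
  have hc : Continuous (fun x => ((deriv g x : ℝ) : ℂ)) :=
    Complex.continuous_ofReal.comp (hg.continuous_deriv le_rfl)
  have hz : ∀ x, x ∉ Ioo 0 (2 * Real.pi) → g x = 0 := fun x hx =>
    image_eq_zero_of_notMem_tsupport fun h => hx (hs h)
  refine ⟨?_, fun x _ => ?_, ?_⟩
  · obtain ⟨C, hC⟩ := isCompact_Icc.exists_bound_of_continuousOn
      (hc.continuousOn (s := Icc 0 (2 * Real.pi)))
    refine MemLp.of_bound hc.aestronglyMeasurable C ?_
    exact (ae_restrict_mem measurableSet_Ioo).mono fun x hx => hC x (Ioo_subset_Icc_self hx)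
  · rw [intervalIntegral.integral_eq_sub_of_hasDerivAt (f := fun x => (g x : ℂ))
      (fun t _ => (hg.differentiable one_ne_zero t).hasDerivAt.ofReal_comp)
      (hc.intervalIntegrable _ _)]
    ring
  · simp [hz]

/-- The form domain is dense in `L²(I)`, so that the graph is the graph of an operator. -/
theorem graph_functional (α : ℝ) (Y : Finset ℝ) :
    ∀ p ∈ graph α Y, p.1 = 0 → p.2 = 0 := by
  rintro ⟨u, f⟩ ⟨ψ, dψ, h, hu, hf⟩ rfl
  have hψ : ψ =ᵐ[loopMeasure] fun _ => (0 : ℂ) :=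
    hu.symm.trans (Lp.coeFn_zero ℂ 2 loopMeasure)
  have h0 : (0 : ℝ) < 2 * Real.pi := by positivity
  have hIcc : ∀ x ∈ Icc 0 (2 * Real.pi), ψ x = 0 := by
    have hae : ψ =ᵐ[volume.restrict (Icc 0 (2 * Real.pi))] fun _ => (0 : ℂ) := by
      rw [← restrict_Ioo_eq_restrict_Icc]; exact hψ
    exact Measure.eqOn_Icc_of_ae_eq volume h0.ne hae h.continuousOn continuousOn_const
  have hd : dψ =ᵐ[loopMeasure] fun _ => (0 : ℂ) := by
    have hder := h.intervalIntegrable.ae_hasDerivAt_integral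
    rw [Filter.EventuallyEq, ae_restrict_iff' measurableSet_Ioo]
    filter_upwards [hder] with x hx hxI
    have h1 := hx (by rw [uIcc_of_le h0.le]; exact Ioo_subset_Icc_self hxI) 0
      (by rw [uIcc_of_le h0.le]; exact ⟨le_rfl, h0.le⟩)
    have h2 : (fun y => ∫ t in (0 : ℝ)..y, dψ t) =ᶠ[nhds x] fun _ => (0 : ℂ) := by
      filter_upwards [isOpen_Ioo.mem_nhds hxI] with y hy
      have := h.eq_primitive y (Ioo_subset_Icc_self hy)
      rw [hIcc y (Ioo_subset_Icc_self hy), hIcc 0 ⟨le_rfl, h0.le⟩, zero_add] at this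
      exact this.symm
    exact (h1.congr_of_eventuallyEq h2.symm).unique (hasDerivAt_const x 0)
  have hzero : ∀ᵐ x, x ∈ Ioo 0 (2 * Real.pi) → f x = 0 := by
    refine isOpen_Ioo.ae_eq_zero_of_integral_contDiff_smul_eq_zero ?_ fun g hg _ hs => ?_
    · have hf1 : IntegrableOn f (Ioo 0 (2 * Real.pi)) volume :=
        (Lp.memLp f).integrable (by norm_num)
      exact hf1.locallyIntegrableOn
    · have key := hf _ _ (isPeriodicH1_of_contDiff (hg.of_le (by exact_mod_cast le_top)) hs)
      have hl : form α Y (fun x => (g x : ℂ)) (fun x => ((deriv g x : ℝ) : ℂ)) ψ dψ = 0 := by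
        have e1 : (fun x => conj ((deriv g x : ℝ) : ℂ) * dψ x) =ᵐ[loopMeasure] fun _ => 0 := by
          filter_upwards [hd] with x hx
          simp [hx]
        have e2 : ∀ y ∈ Y, conj (g y : ℂ) * ψ y = 0 := by
          intro y _
          by_cases hy : y ∈ Ioo 0 (2 * Real.pi)
          · rw [hIcc y (Ioo_subset_Icc_self hy), mul_zero]
          · rw [image_eq_zero_of_notMem_tsupport fun h => hy (hs h)]
            simp
        rw [form, integral_congr_ae e1, Finset.sum_eq_zero e2]
        simp
      rw [hl] at key
      rw [← setIntegral_eq_integral_of_forall_compl_eq_zero (s := Ioo 0 (2 * Real.pi)), key]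
      · simp
      · intro x hx
        rw [image_eq_zero_of_notMem_tsupport fun h => hx (hs h), zero_smul]
  rw [← ae_restrict_iff' measurableSet_Ioo] at hzero
  refine Lp.ext ?_
  filter_upwards [hzero, Lp.coeFn_zero ℂ 2 loopMeasure] with x hx hx0
  rw [hx, hx0, Pi.zero_apply]

/-- The Hamiltonian `H_{α,Y} = -d²/dx² + α ∑_{y ∈ Y} δ(x - y)` on the loop of length `2π`, as an
unbounded operator in `L²(I)`: the operator associated with the form `q_{α,Y}`. -/
def hamiltonian (α : ℝ) (Y : Finset ℝ) : L2 →ₗ.[ℂ] L2 :=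
  (graph α Y).toLinearPMap

theorem hamiltonian_graph (α : ℝ) (Y : Finset ℝ) : (hamiltonian α Y).graph = graph α Y :=
  Submodule.toLinearPMap_graph_eq _ (fun p hp h => graph_functional α Y p hp h)

/-- The set of (real) eigenvalues of `H_{α,Y}`. -/
def eigenvalues (α : ℝ) (Y : Finset ℝ) : Set ℝ :=
  {l | ∃ u : (hamiltonian α Y).domain, (u : L2) ≠ 0 ∧ hamiltonian α Y u = (l : ℂ) • (u : L2)}

/-- The lowest eigenvalue `λ₁(α, Y)` of `H_{α,Y}`. -/
def groundEnergy (α : ℝ) (Y : Finset ℝ) : ℝ :=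
  sInf (eigenvalues α Y)

/-- The equidistant set `{(π / N) (2 j - 1) : j = 1, …, N}`. -/
def equidistant (N : ℕ) : Finset ℝ :=
  (Finset.Icc 1 N).image fun j : ℕ => Real.pi / N * (2 * j - 1)

/-- Congruence of two point sets on the loop `ℝ / 2πℤ` with its arc-length distance: some isometry
of the loop maps one set onto the other. -/
def Congruent (Y Z : Finset ℝ) : Prop :=
  ∃ e : AddCircle (2 * Real.pi) ≃ᵢ AddCircle (2 * Real.pi),
    e '' ((fun y : ℝ => (y : AddCircle (2 * Real.pi))) '' (Y : Set ℝ)) =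
      (fun y : ℝ => (y : AddCircle (2 * Real.pi))) '' (Z : Set ℝ)

end LoopDelta

end

noncomputable section

namespace LoopDelta

/-! The ground state of the equidistant configuration is symmetric on each gap: it is an even
solution `C` of `C'' = -l C` centred at the midpoint. With `T = -C'/C`, the jump condition at the
points reads `2 T(π/N) = α`. For α > 0 this gives `l = k²`, `T(x) = k tan(kx)`; for α < 0 it gives
`l = -k²`, `T(x) = -k tanh(kx)`. In both cases `T' = l + T²`.

Fix this `l` and take any configuration with half-gaps `h_j`, so that `∑ h_j = π`. Gluing copies of
`C`, scaled to the value 1 at every point, yields a trial function whose form exceeds `l` times its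
squared norm by `αN - 2 ∑ T(h_j)` (`Chain.exists_test`). On `[0, π]` the function `T` is convex,
because `T²` increases, and strictly so when α ≠ 0 (`Profile.strictConvexOn`). Jensen's inequality
gives `∑ T(h_j) ≥ N T(π/N) = αN/2`. Hence the lowest eigenvalue is at most `l`, and is below `l`
when α ≠ 0 and the gaps are unequal.

When all gaps are equal, `l` is also a lower bound. Completing the square with the Riccati solution
`-T` (`IsPeriodicH1.integral_riccati`, `Chain.energy_eq`) turns the form minus `l` times the squared
norm into point terms, which cancel against the delta terms, plus a nonnegative remainder
(`Chain.le_energy`). Equal gaps amount to congruence with the equidistant set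
(`Chain.congruent_of_half`, `Chain.half_of_congruent`).

The lowest eigenvalue exists and equals the minimum of the Rayleigh quotient by the direct method
(`exists_minimizer`, `groundEnergy_spec`). Small |α| makes the form coercive and keeps `C` positive
on gaps as long as the whole loop. -/

/-! ### The Riccati identity on an interval. -/

/-- A real function with a continuous derivative on a compact interval is absolutely continuous. -/
theorem absolutelyContinuousOnInterval_of_hasDerivAt {w w' : ℝ → ℝ} {a b : ℝ}
    (hw : ∀ x ∈ uIcc a b, HasDerivAt w (w' x) x) (hc : ContinuousOn w' (uIcc a b)) :
    AbsolutelyContinuousOnInterval w a b := by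
  obtain ⟨C, hC⟩ := isCompact_uIcc.exists_bound_of_continuousOn hc
  have h0 : 0 ≤ C := (norm_nonneg _).trans (hC a left_mem_uIcc)
  refine LipschitzOnWith.absolutelyContinuousOnInterval (K := ⟨C, h0⟩) ?_
  exact (convex_uIcc a b).lipschitzOnWith_of_nnnorm_hasDerivWithin_le
    (fun x hx => (hw x hx).hasDerivWithinAt) fun x hx => hC x hx

theorem IsPeriodicH1.subset_uIcc {a b : ℝ} (ha : 0 ≤ a) (hab : a ≤ b) (hb : b ≤ 2 * Real.pi) :
    uIcc a b ⊆ uIcc 0 (2 * Real.pi) := by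
  rw [uIcc_of_le hab, uIcc_of_le (ha.trans (hab.trans hb))]
  exact Icc_subset_Icc ha hb

/-- Square-integrable functions on `I` have integrable squared norm on subintervals. -/
theorem intervalIntegrable_norm_sq {f : ℝ → ℂ} (hf : MemLp f 2 loopMeasure) {a b : ℝ}
    (ha : 0 ≤ a) (hab : a ≤ b) (hb : b ≤ 2 * Real.pi) :
    IntervalIntegrable (fun x => ‖f x‖ ^ 2) volume a b := by
  have h : IntervalIntegrable (fun x => ‖f x‖ ^ 2) volume 0 (2 * Real.pi) := by
    rw [intervalIntegrable_iff_integrableOn_Ioo_of_le (by positivity)]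
    exact (memLp_two_iff_integrable_sq_norm hf.1).1 hf
  exact h.mono_set (IsPeriodicH1.subset_uIcc ha hab hb)

theorem norm_sub_smul_sq (z v : ℂ) (w : ℝ) :
    ‖z - w • v‖ ^ 2 = ‖z‖ ^ 2 - 2 * w * (v.re * z.re + v.im * z.im) + w ^ 2 * ‖v‖ ^ 2 := by
  simp only [← Complex.normSq_eq_norm_sq, Complex.normSq_apply, Complex.sub_re, Complex.sub_im,
    Complex.real_smul, Complex.re_ofReal_mul, Complex.im_ofReal_mul]
  ring

/-- Completing the square: if `w` solves the Riccati equation `w' = -l - w²`, the energy of a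
periodic `H¹` function on a subinterval is a boundary term plus a nonnegative remainder. -/
theorem IsPeriodicH1.integral_riccati {ψ dψ : ℝ → ℂ} (h : IsPeriodicH1 ψ dψ) {a b l : ℝ}
    (ha : 0 ≤ a) (hab : a ≤ b) (hb : b ≤ 2 * Real.pi) {w : ℝ → ℝ}
    (hw : ∀ x ∈ Icc a b, HasDerivAt w (-l - w x ^ 2) x) :
    ∫ x in a..b, (‖dψ x‖ ^ 2 - l * ‖ψ x‖ ^ 2) =
      w b * ‖ψ b‖ ^ 2 - w a * ‖ψ a‖ ^ 2 + ∫ x in a..b, ‖dψ x - w x • ψ x‖ ^ 2 := by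
  have hs := subset_uIcc ha hab hb
  have hu : uIcc a b = Icc a b := uIcc_of_le hab
  have hwc : ContinuousOn w (uIcc a b) := fun x hx =>
    (hw x (hu ▸ hx)).continuousAt.continuousWithinAt
  have hI := h.intervalIntegrable
  have prim : ∀ (c : ℝ) {g : ℝ → ℝ}, IntervalIntegrable g volume 0 (2 * Real.pi) →
      AbsolutelyContinuousOnInterval (fun x => c + ∫ t in (0 : ℝ)..x, g t) a b ∧
      ∀ᵐ x, x ∈ uIcc a b → HasDerivAt (fun x => c + ∫ t in (0 : ℝ)..x, g t) (g x) x := by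
    intro c g hg
    refine ⟨?_, ?_⟩
    · exact ((LipschitzWith.const c).lipschitzOnWith.absolutelyContinuousOnInterval).fun_add
        ((hg.absolutelyContinuousOnInterval_intervalIntegral (c := 0) left_mem_uIcc).mono hs)
    · filter_upwards [hg.ae_hasDerivAt_integral] with x hx hxab
      exact (hx (hs hxab) 0 left_mem_uIcc).const_add _
  -- The values of ψ outside `[0, 2π]` are arbitrary, so two-sided derivatives at the ends are taken
  -- of the primitives of `Re dψ` and `Im dψ`, which agree with `Re ψ` and `Im ψ` on `[a, b]`.
  obtain ⟨hRac, hRd⟩ := prim (ψ 0).re (g := fun x => (dψ x).re) ⟨hI.1.re, hI.2.re⟩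
  obtain ⟨hJac, hJd⟩ := prim (ψ 0).im (g := fun x => (dψ x).im) ⟨hI.1.im, hI.2.im⟩
  set R : ℝ → ℝ := fun x => (ψ 0).re + ∫ t in (0 : ℝ)..x, (dψ t).re
  set J : ℝ → ℝ := fun x => (ψ 0).im + ∫ t in (0 : ℝ)..x, (dψ t).im
  have hsub : ∀ x ∈ Icc a b, IntervalIntegrable dψ volume 0 x := fun x hx =>
    hI.mono_set (subset_uIcc le_rfl (ha.trans hx.1) (hx.2.trans hb))
  have hR : ∀ x ∈ Icc a b, (ψ x).re = R x := fun x hx => by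
    rw [h.eq_primitive x ⟨ha.trans hx.1, hx.2.trans hb⟩, Complex.add_re]
    exact congrArg _ (Complex.reCLM.intervalIntegral_comp_comm (hsub x hx)).symm
  have hJ : ∀ x ∈ Icc a b, (ψ x).im = J x := fun x hx => by
    rw [h.eq_primitive x ⟨ha.trans hx.1, hx.2.trans hb⟩, Complex.add_im]
    exact congrArg _ (Complex.imCLM.intervalIntegral_comp_comm (hsub x hx)).symm
  have hn : ∀ x ∈ Icc a b, ‖ψ x‖ ^ 2 = R x * R x + J x * J x := fun x hx => by
    rw [← Complex.normSq_eq_norm_sq, Complex.normSq_apply, hR x hx, hJ x hx]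
  have hwac : AbsolutelyContinuousOnInterval w a b :=
    absolutelyContinuousOnInterval_of_hasDerivAt (w' := fun x => -l - w x ^ 2)
      (fun x hx => hw x (hu ▸ hx)) (continuousOn_const.sub (hwc.pow 2))
  have hF : AbsolutelyContinuousOnInterval (fun x => w x * (R x * R x + J x * J x)) a b :=
    hwac.fun_mul ((hRac.fun_mul hRac).fun_add (hJac.fun_mul hJac))
  have key := hF.integral_deriv_eq_sub
  -- The Riccati equation makes the derivative of `w |ψ|²` equal to `|ψ'|² - l|ψ|² - |ψ' - wψ|²`.
  have hae : ∀ᵐ x, x ∈ uIoc a b → deriv (fun x => w x * (R x * R x + J x * J x)) x =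
      ‖dψ x‖ ^ 2 - l * ‖ψ x‖ ^ 2 - ‖dψ x - w x • ψ x‖ ^ 2 := by
    filter_upwards [hRd, hJd] with x h1 h2 hxm
    have hx' := uIoc_subset_uIcc hxm
    have hxI : x ∈ Icc a b := hu ▸ hx'
    refine ((hw x hxI).mul (((h1 hx').mul (h1 hx')).add ((h2 hx').mul (h2 hx')))).deriv.trans ?_
    rw [norm_sub_smul_sq, hn x hxI, hR x hxI, hJ x hxI]
    simp only [Pi.add_apply, Pi.mul_apply]
    ring
  have hint1 : IntervalIntegrable (fun x => ‖dψ x‖ ^ 2 - l * ‖ψ x‖ ^ 2) volume a b :=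
    (intervalIntegrable_norm_sq h.memLp_deriv ha hab hb).sub
      ((intervalIntegrable_norm_sq h.memLp ha hab hb).const_mul l)
  have hint2 : IntervalIntegrable (fun x => ‖dψ x - w x • ψ x‖ ^ 2) volume a b := by
    refine (hint1.sub hF.intervalIntegrable_deriv).congr_ae ?_
    rw [Filter.EventuallyEq, ae_restrict_iff' measurableSet_uIoc]
    filter_upwards [hae] with x hx hxm
    have := hx hxm
    linarith
  rw [intervalIntegral.integral_congr_ae hae, intervalIntegral.integral_sub hint1 hint2,
    ← hn b ⟨hab, le_rfl⟩, ← hn a ⟨le_rfl, hab⟩] at key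
  linarith

/-! ### Profiles, gaps of a configuration, and the energy identity on the loop. -/

/-- A profile with energy parameter `l`: a positive even solution `C` of `C'' = -l C` on `[-π, π]`
together with `T = -C' / C`. -/
structure Profile (l : ℝ) (C T : ℝ → ℝ) : Prop where
  pos : ∀ x ∈ Icc (-Real.pi) Real.pi, 0 < C x
  even : ∀ x, C (-x) = C x
  odd : ∀ x, T (-x) = -T x
  deriv_C : ∀ x ∈ Icc (-Real.pi) Real.pi, HasDerivAt C (-T x * C x) x
  deriv_T : ∀ x ∈ Icc (-Real.pi) Real.pi, HasDerivAt T (l + T x ^ 2) x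

/-- An enumeration `p 1 < ⋯ < p N` of a point set on the loop, continued by one step
on both sides. -/
structure Chain (N : ℕ) (p : ℕ → ℝ) (Y : Finset ℝ) : Prop where
  lt_succ : ∀ j ≤ N, p j < p (j + 1)
  mem_Ioo : ∀ j ∈ Finset.Icc 1 N, p j ∈ Ioo 0 (2 * Real.pi)
  wrap_last : p N = p 0 + 2 * Real.pi
  wrap_first : p (N + 1) = p 1 + 2 * Real.pi
  image_eq : (Finset.Icc 1 N).image p = Y

/-- The midpoint of the gap between `p j` and `p (j + 1)`. -/
def mid (p : ℕ → ℝ) (j : ℕ) : ℝ := (p j + p (j + 1)) / 2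

/-- Half the length of the gap between `p j` and `p (j + 1)`. -/
def half (p : ℕ → ℝ) (j : ℕ) : ℝ := (p (j + 1) - p j) / 2

/-- The point `p j`, moved into `[0, 2π]`. -/
def knot (p : ℕ → ℝ) (j : ℕ) : ℝ := max 0 (min (p j) (2 * Real.pi))

section

variable {N : ℕ} {p : ℕ → ℝ} {Y : Finset ℝ}

theorem Chain.mono (hp : Chain N p Y) {i j : ℕ} (hij : i ≤ j) (hj : j ≤ N + 1) : p i ≤ p j := by
  induction j, hij using Nat.le_induction with
  | base => exact le_rfl
  | succ k hk ih => exact (ih (by omega)).trans (hp.lt_succ k (by omega)).le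

theorem Chain.strictMono (hp : Chain N p Y) {i j : ℕ} (hij : i < j) (hj : j ≤ N + 1) :
    p i < p j :=
  (hp.lt_succ i (by omega)).trans_le (hp.mono hij hj)

theorem Chain.zero_neg (hp : Chain N p Y) (hN : 1 ≤ N) : p 0 < 0 := by
  have := (hp.mem_Ioo N (by simp [hN])).2
  linarith [hp.wrap_last]

theorem Chain.lt_last (hp : Chain N p Y) (hN : 1 ≤ N) : 2 * Real.pi < p (N + 1) := by
  have := (hp.mem_Ioo 1 (by simp [hN])).1
  linarith [hp.wrap_first]

theorem Chain.knot_zero (hp : Chain N p Y) (hN : 1 ≤ N) : knot p 0 = 0 :=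
  max_eq_left ((min_le_left _ _).trans (hp.zero_neg hN).le)

theorem Chain.knot_last (hp : Chain N p Y) (hN : 1 ≤ N) : knot p (N + 1) = 2 * Real.pi := by
  rw [knot, min_eq_right (hp.lt_last hN).le, max_eq_right (by positivity)]

theorem Chain.knot_eq (hp : Chain N p Y) {j : ℕ} (h1 : 1 ≤ j) (h2 : j ≤ N) : knot p j = p j := by
  have := hp.mem_Ioo j (by simp [h1, h2])
  rw [knot, min_eq_left this.2.le, max_eq_right this.1.le]

theorem knot_nonneg (p : ℕ → ℝ) (j : ℕ) : 0 ≤ knot p j := le_max_left _ _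

theorem knot_le (p : ℕ → ℝ) (j : ℕ) : knot p j ≤ 2 * Real.pi :=
  max_le (by positivity) (min_le_right _ _)

theorem Chain.knot_mono (hp : Chain N p Y) {j : ℕ} (hj : j ≤ N) : knot p j ≤ knot p (j + 1) :=
  max_le_max le_rfl (min_le_min (hp.lt_succ j hj).le le_rfl)

theorem Chain.le_knot (hp : Chain N p Y) (hN : 1 ≤ N) {j : ℕ} (hj : j ≤ N) : p j ≤ knot p j := by
  rcases Nat.eq_zero_or_pos j with rfl | h
  · rw [hp.knot_zero hN]; exact (hp.zero_neg hN).le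
  · exact (hp.knot_eq h hj).ge

theorem Chain.knot_succ_le (hp : Chain N p Y) (hN : 1 ≤ N) {j : ℕ} (hj : j ≤ N) :
    knot p (j + 1) ≤ p (j + 1) := by
  rcases hj.eq_or_lt with rfl | h
  · rw [hp.knot_last hN]; exact (hp.lt_last hN).le
  · exact (hp.knot_eq (by omega) h).le

theorem Chain.half_pos (hp : Chain N p Y) {j : ℕ} (hj : j ≤ N) : 0 < half p j := by
  have := hp.lt_succ j hj
  rw [half]; linarith

/-- No gap is longer than the loop. This is why profiles need to be positive only on `[-π, π]`. -/
theorem Chain.half_le (hp : Chain N p Y) (hN : 1 ≤ N) {j : ℕ} (hj : j ≤ N) :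
    half p j ≤ Real.pi := by
  rw [half]
  rcases Nat.eq_zero_or_pos j with rfl | h
  · have := hp.mono hN (Nat.le_succ N)
    simp only [zero_add]
    linarith [hp.wrap_last]
  · have := hp.mono h (hj.trans (Nat.le_succ N))
    have := hp.mono (Nat.succ_le_succ hj) le_rfl
    simp only [Nat.succ_eq_add_one] at *
    linarith [hp.wrap_first]

theorem Chain.half_last (hp : Chain N p Y) : half p N = half p 0 := by
  rw [half, half, hp.wrap_first, hp.wrap_last]; ring

theorem Chain.mid_last (hp : Chain N p Y) : mid p N = mid p 0 + 2 * Real.pi := by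
  rw [mid, mid, hp.wrap_first, hp.wrap_last]; ring

theorem Chain.sub_mid_mem (hp : Chain N p Y) (hN : 1 ≤ N) {j : ℕ} (hj : j ≤ N) {x : ℝ}
    (hx : x ∈ Icc (p j) (p (j + 1))) : x - mid p j ∈ Icc (-Real.pi) Real.pi := by
  have h := hp.half_le hN hj
  rw [half] at h
  rw [mid]
  constructor <;> linarith [hx.1, hx.2]

theorem Chain.half_mem (hp : Chain N p Y) (hN : 1 ≤ N) {j : ℕ} (hj : j ≤ N) :
    half p j ∈ Icc (-Real.pi) Real.pi :=
  ⟨by linarith [Real.pi_pos, hp.half_pos hj], hp.half_le hN hj⟩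

theorem sub_mid_left (p : ℕ → ℝ) (j : ℕ) : p j - mid p j = -half p j := by
  rw [mid, half]; ring

theorem sub_mid_right (p : ℕ → ℝ) (j : ℕ) : p (j + 1) - mid p j = half p j := by
  rw [mid, half]; ring

theorem Chain.sum_eq (hp : Chain N p Y) {M : Type*} [AddCommMonoid M] (f : ℝ → M) :
    ∑ y ∈ Y, f y = ∑ j ∈ Finset.range N, f (p (j + 1)) := by
  rw [← hp.image_eq, Finset.sum_image, Finset.range_eq_Ico, Finset.sum_Ico_add' (fun j => f (p j))]
  · rfl
  · intro i hi j hj hij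
    simp only [Finset.coe_Icc, mem_Icc] at hi hj
    rcases lt_trichotomy i j with h | h | h
    · exact absurd hij (hp.strictMono h (by omega)).ne
    · exact h
    · exact absurd hij (hp.strictMono h (by omega)).ne'

theorem Chain.sum_half (hp : Chain N p Y) : ∑ j ∈ Finset.range N, half p j = Real.pi := by
  simp only [half, ← Finset.sum_div]
  rw [Finset.sum_range_sub, hp.wrap_last]; ring

/-- Gaps `0` and `N` are the same gap of the loop, so the shift is cyclic. -/
theorem Chain.sum_half_succ (hp : Chain N p Y) (f : ℝ → ℝ) :
    ∑ j ∈ Finset.range N, f (half p (j + 1)) = ∑ j ∈ Finset.range N, f (half p j) := by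
  have h1 := Finset.sum_range_succ (fun j => f (half p j)) N
  have h2 := Finset.sum_range_succ' (fun j => f (half p j)) N
  rw [hp.half_last] at h1
  linarith

/-- The energy of a periodic `H¹` function is a sum of point evaluations and a nonnegative
remainder, which vanishes for the test function adapted to the profile. -/
theorem Chain.energy_eq (hp : Chain N p Y) (hN : 1 ≤ N) {l : ℝ} {C T : ℝ → ℝ}
    (hT : Profile l C T) {ψ dψ : ℝ → ℂ} (h : IsPeriodicH1 ψ dψ) :
    ∫ x in (0 : ℝ)..(2 * Real.pi), (‖dψ x‖ ^ 2 - l * ‖ψ x‖ ^ 2) =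
      -∑ j ∈ Finset.range N, (T (half p j) + T (half p (j + 1))) * ‖ψ (p (j + 1))‖ ^ 2 +
      ∑ j ∈ Finset.range (N + 1), ∫ x in knot p j..knot p (j + 1),
        ‖dψ x - (-T (x - mid p j)) • ψ x‖ ^ 2 := by
  have hint : ∀ j < N + 1, IntervalIntegrable (fun x => ‖dψ x‖ ^ 2 - l * ‖ψ x‖ ^ 2) volume
      (knot p j) (knot p (j + 1)) := fun j hj =>
    (intervalIntegrable_norm_sq h.memLp_deriv (knot_nonneg p j) (hp.knot_mono (by omega))
      (knot_le p _)).sub ((intervalIntegrable_norm_sq h.memLp (knot_nonneg p j)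
        (hp.knot_mono (by omega)) (knot_le p _)).const_mul l)
  have hsum := intervalIntegral.sum_integral_adjacent_intervals hint
  rw [hp.knot_zero hN, hp.knot_last hN] at hsum
  have hw : ∀ j < N + 1, ∀ x ∈ Icc (knot p j) (knot p (j + 1)),
      HasDerivAt (fun x => -T (x - mid p j)) (-l - (-T (x - mid p j)) ^ 2) x := by
    intro j hj x hx
    have hm := hp.sub_mid_mem hN (j := j) (by omega) (x := x)
      ⟨(hp.le_knot hN (by omega)).trans hx.1, hx.2.trans (hp.knot_succ_le hN (by omega))⟩
    exact ((hT.deriv_T _ hm).comp_sub_const x (mid p j)).fun_neg.congr_deriv (by ring)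
  rw [← hsum, Finset.sum_congr rfl fun j hj => h.integral_riccati (knot_nonneg p j)
    (hp.knot_mono (Nat.lt_succ_iff.1 (Finset.mem_range.1 hj))) (knot_le p _)
    (hw j (Finset.mem_range.1 hj)), Finset.sum_add_distrib]
  congr 1
  -- The boundary terms are regrouped by point instead of by gap. The two left over, at `2π` and at
  -- `0`, cancel: ψ is periodic and the midpoints of gaps `N` and `0` differ by `2π`.
  rw [Finset.sum_sub_distrib, Finset.sum_range_succ,
    Finset.sum_range_succ' (fun j => -T (knot p j - mid p j) * ‖ψ (knot p j)‖ ^ 2),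
    hp.knot_zero hN, hp.knot_last hN, hp.mid_last, h.periodic]
  have e : ∀ j ∈ Finset.range N,
      -T (knot p (j + 1) - mid p j) * ‖ψ (knot p (j + 1))‖ ^ 2 -
        -T (knot p (j + 1) - mid p (j + 1)) * ‖ψ (knot p (j + 1))‖ ^ 2 =
      -((T (half p j) + T (half p (j + 1))) * ‖ψ (p (j + 1))‖ ^ 2) := by
    intro j hj
    rw [hp.knot_eq (by omega) (Finset.mem_range.1 hj), sub_mid_right, sub_mid_left, hT.odd]
    ring
  rw [← Finset.sum_neg_distrib, ← Finset.sum_congr rfl e, Finset.sum_sub_distrib,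
    show 2 * Real.pi - (mid p 0 + 2 * Real.pi) = 0 - mid p 0 by ring]
  ring

theorem Chain.exists_gap (hp : Chain N p Y) (hN : 1 ≤ N) {x : ℝ}
    (hx : x ∈ Icc 0 (2 * Real.pi)) : ∃ j ≤ N, x ∈ Ico (p j) (p (j + 1)) := by
  by_contra! hc
  have : ∀ j ≤ N + 1, p j ≤ x := by
    intro j
    induction j with
    | zero => exact fun _ => (hp.zero_neg hN).le.trans hx.1
    | succ k ih =>
      intro hk
      by_contra! h
      exact hc k (by omega) ⟨ih (by omega), h⟩
  exact absurd (this (N + 1) le_rfl) (not_le.2 (hx.2.trans_lt (hp.lt_last hN)))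

end

/-! ### The glued trial function. -/

/-- The test function: on the gap between `p j` and `p (j + 1)` it is the profile centred at the
midpoint, normalized to have the value `1` at the ends. -/
def testFun (C : ℝ → ℝ) (N : ℕ) (p : ℕ → ℝ) (x : ℝ) : ℝ :=
  1 + ∑ j ∈ Finset.range (N + 1),
    (C (max (p j) (min x (p (j + 1))) - mid p j) / C (half p j) - 1)

section

variable {N : ℕ} {p : ℕ → ℝ} {Y : Finset ℝ} {l : ℝ} {C T : ℝ → ℝ}

/-- Clamping `x` to any other gap lands on an end of that gap, where the normalized profile is 1 and
its summand vanishes. The clamped sum is used because it is visibly continuous. -/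
theorem Chain.testFun_eq (hp : Chain N p Y) (hN : 1 ≤ N) (hT : Profile l C T) {j : ℕ}
    (hj : j ≤ N) {x : ℝ} (hx : x ∈ Icc (p j) (p (j + 1))) :
    testFun C N p x = C (x - mid p j) / C (half p j) := by
  rw [testFun, Finset.sum_eq_single j]
  · rw [min_eq_left hx.2, max_eq_right hx.1]; ring
  · intro i hi hij
    have hi' : i ≤ N := Nat.lt_succ_iff.1 (Finset.mem_range.1 hi)
    have hC : C (half p i) ≠ 0 := (hT.pos _ (hp.half_mem hN hi')).ne'
    rcases lt_or_gt_of_ne hij with h | h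
    · have h1 : p (i + 1) ≤ x := (hp.mono h (by omega)).trans hx.1
      rw [min_eq_right h1, max_eq_right (hp.lt_succ i hi').le, sub_mid_right, div_self hC,
        sub_self]
    · have h1 : x ≤ p i := hx.2.trans (hp.mono h (by omega))
      rw [max_eq_left ((min_le_left _ _).trans h1), sub_mid_left, hT.even, div_self hC, sub_self]
  · intro h
    exact absurd (Finset.mem_range.2 (Nat.lt_succ_of_le hj)) h

theorem Chain.testFun_point (hp : Chain N p Y) (hN : 1 ≤ N) (hT : Profile l C T) {j : ℕ}
    (hj : j ≤ N) : testFun C N p (p j) = 1 := by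
  rw [hp.testFun_eq hN hT hj ⟨le_rfl, (hp.lt_succ j hj).le⟩, sub_mid_left, hT.even,
    div_self (hT.pos _ (hp.half_mem hN hj)).ne']

theorem Chain.continuous_testFun (hp : Chain N p Y) (hN : 1 ≤ N) (hT : Profile l C T) :
    Continuous (testFun C N p) := by
  have hC : ContinuousOn C (Icc (-Real.pi) Real.pi) := fun x hx =>
    (hT.deriv_C x hx).continuousAt.continuousWithinAt
  refine continuous_const.add (continuous_finsetSum _ fun j hj => ?_)
  have hj' : j ≤ N := Nat.lt_succ_iff.1 (Finset.mem_range.1 hj)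
  refine (Continuous.div_const ?_ _).sub continuous_const
  refine hC.comp_continuous (by fun_prop) fun x => hp.sub_mid_mem hN hj' ⟨le_max_left _ _, ?_⟩
  exact max_le (hp.lt_succ j hj').le (min_le_right _ _)

theorem Chain.hasDerivAt_testFun (hp : Chain N p Y) (hN : 1 ≤ N) (hT : Profile l C T) {j : ℕ}
    (hj : j ≤ N) {x : ℝ} (hx : x ∈ Ioo (p j) (p (j + 1))) :
    HasDerivAt (testFun C N p) (-T (x - mid p j) * testFun C N p x) x := by
  have h1 := ((hT.deriv_C _ (hp.sub_mid_mem hN hj (Ioo_subset_Icc_self hx))).comp_sub_const x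
    (mid p j)).div_const (C (half p j))
  rw [hp.testFun_eq hN hT hj (Ioo_subset_Icc_self hx)]
  refine (h1.congr_of_eventuallyEq ?_).congr_deriv (by ring)
  filter_upwards [isOpen_Ioo.mem_nhds hx] with y hy
  exact hp.testFun_eq hN hT hj (Ioo_subset_Icc_self hy)

theorem Chain.exists_open_gap (hp : Chain N p Y) (hN : 1 ≤ N) {x : ℝ}
    (hx : x ∈ Icc 0 (2 * Real.pi)) (hxp : x ∉ p '' Iic N) :
    ∃ j ≤ N, x ∈ Ioo (p j) (p (j + 1)) := by
  obtain ⟨j, hj, hxj⟩ := hp.exists_gap hN hx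
  exact ⟨j, hj, hxj.1.lt_of_ne fun h => hxp ⟨j, hj, h⟩, hxj.2⟩

/-- Off the countable set of points the derivative exists and is bounded, since it is `-T` times the
function. Together with continuity this suffices for the fundamental theorem of calculus. -/
theorem Chain.isPeriodicH1_testFun (hp : Chain N p Y) (hN : 1 ≤ N) (hT : Profile l C T) :
    IsPeriodicH1 (fun x => (testFun C N p x : ℂ))
      (fun x => ((deriv (testFun C N p) x : ℝ) : ℂ)) := by
  have hcnt : (p '' Iic N).Countable := (Set.to_countable _).image p
  have hcont := hp.continuous_testFun hN hT
  obtain ⟨A, hA⟩ := isCompact_Icc.exists_bound_of_continuousOn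
    (f := T) (s := Icc (-Real.pi) Real.pi)
    fun x hx => (hT.deriv_T x hx).continuousAt.continuousWithinAt
  obtain ⟨B, hB⟩ := isCompact_Icc.exists_bound_of_continuousOn
    (s := Icc 0 (2 * Real.pi)) hcont.continuousOn
  have hder : ∀ x ∈ Icc 0 (2 * Real.pi), x ∉ p '' Iic N →
      HasDerivAt (testFun C N p) (deriv (testFun C N p) x) x ∧
        ‖((deriv (testFun C N p) x : ℝ) : ℂ)‖ ≤ A * B := by
    intro x hx hxp
    obtain ⟨j, hj, hxj⟩ := hp.exists_open_gap hN hx hxp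
    have h1 := hp.hasDerivAt_testFun hN hT hj hxj
    refine ⟨h1.differentiableAt.hasDerivAt, ?_⟩
    have h2 := hA _ (hp.sub_mid_mem hN hj (Ioo_subset_Icc_self hxj))
    rw [h1.deriv, Complex.norm_real, norm_mul, norm_neg]
    exact mul_le_mul h2 (hB x hx) (norm_nonneg _) ((norm_nonneg _).trans h2)
  have hmem : MemLp (fun x => ((deriv (testFun C N p) x : ℝ) : ℂ)) 2 loopMeasure := by
    refine MemLp.of_bound
      (Complex.measurable_ofReal.comp (measurable_deriv _)).aestronglyMeasurable (A * B) ?_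
    filter_upwards [ae_restrict_mem measurableSet_Ioo, hcnt.ae_notMem loopMeasure]
      with x hx hxp
    exact (hder x (Ioo_subset_Icc_self hx) hxp).2
  have hint : IntervalIntegrable (fun x => ((deriv (testFun C N p) x : ℝ) : ℂ)) volume
      0 (2 * Real.pi) := by
    rw [intervalIntegrable_iff_integrableOn_Ioo_of_le (by positivity)]
    exact hmem.integrable (by norm_num)
  refine ⟨hmem, fun x hx => ?_, ?_⟩
  · rw [integral_eq_of_hasDerivAt_off_countable (fun x => (testFun C N p x : ℂ)) _ hcnt
      (by fun_prop) (fun y hy => ?_) (hint.mono_set (IsPeriodicH1.subset_uIcc le_rfl hx.1 hx.2))]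
    · ring
    · rw [min_eq_left hx.1, max_eq_right hx.1] at hy
      exact (hder y ⟨hy.1.1.le, hy.1.2.le.trans hx.2⟩ hy.2).1.ofReal_comp
  · have h0 := hp.testFun_eq hN hT (Nat.zero_le N) (x := 0) ⟨(hp.zero_neg hN).le, by
      simpa using (hp.mem_Ioo 1 (by simp [hN])).1.le⟩
    have h1 := hp.testFun_eq hN hT le_rfl (x := 2 * Real.pi)
      ⟨(hp.mem_Ioo N (by simp [hN])).2.le, (hp.lt_last hN).le⟩
    rw [h0, h1, hp.half_last, hp.mid_last]
    congr 3
    ring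

/-- The trial function satisfies `ψ' = -Tψ` inside each gap, so the remainder in `Chain.energy_eq`
vanishes, and it has the value 1 at every point. -/
theorem Chain.energy_testFun (hp : Chain N p Y) (hN : 1 ≤ N) (hT : Profile l C T) :
    ∫ x in (0 : ℝ)..(2 * Real.pi), (‖((deriv (testFun C N p) x : ℝ) : ℂ)‖ ^ 2 -
        l * ‖(testFun C N p x : ℂ)‖ ^ 2) =
      -(2 * ∑ j ∈ Finset.range N, T (half p j)) := by
  rw [hp.energy_eq hN hT (hp.isPeriodicH1_testFun hN hT)]
  have h0 : ∀ j ∈ Finset.range (N + 1), ∫ x in knot p j..knot p (j + 1),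
      ‖((deriv (testFun C N p) x : ℝ) : ℂ) - (-T (x - mid p j)) • (testFun C N p x : ℂ)‖ ^ 2
        = 0 := by
    intro j hj
    have hj' : j ≤ N := Nat.lt_succ_iff.1 (Finset.mem_range.1 hj)
    rw [intervalIntegral.integral_of_le (hp.knot_mono hj'), integral_Ioc_eq_integral_Ioo]
    refine setIntegral_eq_zero_of_forall_eq_zero fun x hx => ?_
    rw [(hp.hasDerivAt_testFun hN hT hj' ⟨(hp.le_knot hN hj').trans_lt hx.1,
      hx.2.trans_le (hp.knot_succ_le hN hj')⟩).deriv]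
    simp
  have h1 : ∀ j ∈ Finset.range N, (T (half p j) + T (half p (j + 1))) *
      ‖(testFun C N p (p (j + 1)) : ℂ)‖ ^ 2 = T (half p j) + T (half p (j + 1)) := by
    intro j hj
    rw [hp.testFun_point hN hT (Finset.mem_range.1 hj)]
    simp
  rw [Finset.sum_eq_zero h0, Finset.sum_congr rfl h1, Finset.sum_add_distrib, hp.sum_half_succ]
  ring

end

/-! ### Convexity, and profiles for either sign of the coupling. -/

/-- The Riccati equation `T' = l + T²` reduces convexity of `T` to monotonicity of `T²`. -/
theorem Profile.strictConvexOn {l : ℝ} {C T : ℝ → ℝ} (hT : Profile l C T)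
    (hm : StrictMonoOn (fun x => T x ^ 2) (Ioo 0 Real.pi)) :
    StrictConvexOn ℝ (Icc 0 Real.pi) T := by
  have hsub : Icc 0 Real.pi ⊆ Icc (-Real.pi) Real.pi :=
    Icc_subset_Icc_left (by linarith [Real.pi_pos])
  refine StrictMonoOn.strictConvexOn_of_deriv (convex_Icc _ _)
    (fun x hx => (hT.deriv_T x (hsub hx)).continuousAt.continuousWithinAt) ?_
  rw [interior_Icc]
  intro x hx y hy hxy
  rw [(hT.deriv_T x (hsub (Ioo_subset_Icc_self hx))).deriv,
    (hT.deriv_T y (hsub (Ioo_subset_Icc_self hy))).deriv]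
  exact (add_lt_add_iff_left l).2 (hm hx hy hxy)

/-- The bound `k < 1/2` keeps `kx` inside `(-π/2, π/2)` for `|x| ≤ π`. -/
theorem profile_cos {k : ℝ} (hk0 : 0 < k) (hk : k < 1 / 2) :
    Profile (k ^ 2) (fun x => Real.cos (k * x)) (fun x => k * Real.tan (k * x)) where
  pos x hx := by
    refine Real.cos_pos_of_mem_Ioo ⟨?_, ?_⟩ <;> nlinarith [hx.1, hx.2, Real.pi_pos]
  even x := by rw [mul_neg, Real.cos_neg]
  odd x := by rw [mul_neg, Real.tan_neg, mul_neg]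
  deriv_C x hx := by
    have hc : Real.cos (k * x) ≠ 0 := by
      refine (Real.cos_pos_of_mem_Ioo ⟨?_, ?_⟩).ne' <;> nlinarith [hx.1, hx.2, Real.pi_pos]
    refine (((hasDerivAt_id x).const_mul k).cos).congr_deriv ?_
    rw [Real.tan_eq_sin_div_cos]
    simp only [id]
    field_simp
  deriv_T x hx := by
    have hc : Real.cos (k * x) ≠ 0 := by
      refine (Real.cos_pos_of_mem_Ioo ⟨?_, ?_⟩).ne' <;> nlinarith [hx.1, hx.2, Real.pi_pos]
    have h := ((Real.hasDerivAt_tan hc).comp x ((hasDerivAt_id x).const_mul k)).const_mul k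
    refine h.congr_deriv ?_
    rw [Real.tan_eq_sin_div_cos]
    field_simp
    linarith [Real.sin_sq_add_cos_sq (k * x)]

theorem profile_cosh (k : ℝ) :
    Profile (-k ^ 2) (fun x => Real.cosh (k * x)) (fun x => -(k * Real.tanh (k * x))) where
  pos x _ := Real.cosh_pos _
  even x := by rw [mul_neg, Real.cosh_neg]
  odd x := by rw [mul_neg, Real.tanh_neg, mul_neg]
  deriv_C x _ := by
    refine (((hasDerivAt_id x).const_mul k).cosh).congr_deriv ?_
    have := (Real.cosh_pos (k * x)).ne'
    rw [Real.tanh_eq_sinh_div_cosh]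
    simp only [id]
    field_simp
  deriv_T x _ := by
    have hc := (Real.cosh_pos (k * x)).ne'
    have h := ((((hasDerivAt_id x).const_mul k).sinh.div ((hasDerivAt_id x).const_mul k).cosh
      hc).const_mul k).fun_neg
    simp only [id] at h
    refine (h.congr_of_eventuallyEq (.of_forall fun y => ?_)).congr_deriv ?_
    · simp [Real.tanh_eq_sinh_div_cosh]
    · rw [Real.tanh_eq_sinh_div_cosh]
      field_simp
      linarith [Real.cosh_sq (k * x)]

theorem profile_one : Profile 0 (fun _ => 1) (fun _ => 0) where
  pos _ _ := one_pos
  even _ := rfl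
  odd _ := by simp
  deriv_C x _ := by simpa using hasDerivAt_const x (1 : ℝ)
  deriv_T x _ := by simpa using hasDerivAt_const x (0 : ℝ)

theorem tanh_strictMono : StrictMono Real.tanh := by
  intro x y hxy
  rw [Real.tanh_eq_sinh_div_cosh, Real.tanh_eq_sinh_div_cosh,
    div_lt_div_iff₀ (Real.cosh_pos x) (Real.cosh_pos y)]
  have h := Real.sinh_pos_iff.2 (sub_pos.2 hxy)
  rw [Real.sinh_sub] at h
  linarith

/-- For weak coupling there is a profile satisfying the matching condition of the equidistant
configuration. -/
theorem exists_profile {N : ℕ} (hN : 2 ≤ N) {α : ℝ}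
    (h1 : |α| < Real.tan (Real.pi / (2 * N))) (h2 : |α| < 2 * Real.tanh (Real.pi / N)) :
    ∃ (l : ℝ) (C T : ℝ → ℝ), Profile l C T ∧ 2 * T (Real.pi / N) = α ∧
      ConvexOn ℝ (Icc 0 Real.pi) T ∧ (α ≠ 0 → StrictConvexOn ℝ (Icc 0 Real.pi) T) := by
  have hN' : (2 : ℝ) ≤ N := by exact_mod_cast hN
  have hpi := Real.pi_pos
  have hπN : Real.pi / N ≤ Real.pi / 2 := by gcongr
  have hπN0 : 0 < Real.pi / N := by positivity
  rcases lt_trichotomy α 0 with hα | rfl | hα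
  -- Attraction: `l = -k²`. The value at `k = 1` is `tanh(π/N)`, which exceeds `-α/2` by the second
  -- smallness bound.
  · obtain ⟨k, hk, hkα⟩ : (-α / 2) ∈ (fun k : ℝ => k * Real.tanh (k * (Real.pi / N))) ''
        Icc 0 1 := by
      refine intermediate_value_Icc zero_le_one (f := fun k : ℝ => k * Real.tanh (k * (Real.pi / N)))
        (Continuous.continuousOn ?_) ⟨?_, ?_⟩
      · simp only [Real.tanh_eq_sinh_div_cosh]
        exact continuous_id.mul ((by fun_prop : Continuous _).div (by fun_prop)
          fun x => (Real.cosh_pos _).ne')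
      · simp; linarith
      · rw [abs_of_neg hα] at h2
        simp; linarith
    have hk0 : 0 < k := by
      refine hk.1.lt_of_ne ?_
      rintro rfl
      simp at hkα; linarith
    have hP := profile_cosh k
    have hs := hP.strictConvexOn fun x hx y hy hxy => by
      have hm := tanh_strictMono (mul_lt_mul_of_pos_left hxy hk0)
      have hx0 : 0 < Real.tanh (k * x) := by
        simpa using tanh_strictMono (mul_pos hk0 hx.1)
      simp only [neg_sq]
      exact pow_lt_pow_left₀ (mul_lt_mul_of_pos_left hm hk0) (by positivity) two_ne_zero
    refine ⟨_, _, _, hP, ?_, hs.convexOn, fun _ => hs⟩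
    simp only at hkα ⊢
    linarith
  · exact ⟨_, _, _, profile_one, by simp, convexOn_const _ (convex_Icc _ _), fun h => absurd rfl h⟩
  -- Repulsion: `l = k²`. The value at `k = 1/2` is `tan(π/(2N))/2`, strictly above `α/2` by the
  -- first smallness bound, which later yields `k < 1/2`.
  · have hmem : ∀ k ∈ Icc (0 : ℝ) (1 / 2), k * (Real.pi / N) ∈ Ioo (-(Real.pi / 2)) (Real.pi / 2) :=
      fun k hk => ⟨by nlinarith [hk.1], by nlinarith [hk.2, hk.1]⟩
    obtain ⟨k, hk, hkα⟩ : (α / 2) ∈ (fun k : ℝ => k * Real.tan (k * (Real.pi / N))) ''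
        Icc 0 (1 / 2) := by
      refine intermediate_value_Icc (by norm_num)
        (f := fun k : ℝ => k * Real.tan (k * (Real.pi / N))) ?_ ⟨?_, ?_⟩
      · exact continuousOn_id.mul (Real.continuousOn_tan_Ioo.comp (by fun_prop) hmem)
      · simp; linarith
      · rw [abs_of_pos hα] at h1
        rw [show 1 / 2 * (Real.pi / N) = Real.pi / (2 * N) by field_simp]
        linarith
    have hk0 : 0 < k := by
      refine hk.1.lt_of_ne ?_
      rintro rfl
      simp at hkα; linarith
    have hk2 : k < 1 / 2 := by
      refine hk.2.lt_of_ne ?_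
      rintro rfl
      rw [abs_of_pos hα] at h1
      simp only at hkα
      rw [show 1 / 2 * (Real.pi / N) = Real.pi / (2 * N) by field_simp] at hkα
      linarith
    have hP := profile_cos hk0 hk2
    have hs := hP.strictConvexOn fun x hx y hy hxy => by
      have hmem' : ∀ z ∈ Ioo 0 Real.pi, k * z ∈ Ioo 0 (Real.pi / 2) := fun z hz =>
        ⟨mul_pos hk0 hz.1, by nlinarith [hz.1, hz.2]⟩
      have hIoo : Ioo 0 (Real.pi / 2) ⊆ Ioo (-(Real.pi / 2)) (Real.pi / 2) :=
        Ioo_subset_Ioo_left (by linarith)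
      have hm := Real.strictMonoOn_tan (hIoo (hmem' x hx)) (hIoo (hmem' y hy))
        (mul_lt_mul_of_pos_left hxy hk0)
      have hx0 := Real.tan_pos_of_pos_of_lt_pi_div_two (hmem' x hx).1 (hmem' x hx).2
      exact pow_lt_pow_left₀ (mul_lt_mul_of_pos_left hm hk0) (by positivity) two_ne_zero
    refine ⟨_, _, _, hP, ?_, hs.convexOn, fun _ => hs⟩
    simp only at hkα ⊢
    linarith

/-! ### Jensen's inequality for the half-gaps. -/

section

variable {N : ℕ} {p : ℕ → ℝ} {Y : Finset ℝ}

theorem Chain.half_mem_Icc (hp : Chain N p Y) (hN : 1 ≤ N) {j : ℕ} (hj : j ≤ N) :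
    half p j ∈ Icc 0 Real.pi :=
  ⟨(hp.half_pos hj).le, hp.half_le hN hj⟩

/-- Jensen with equal weights: the half-gaps sum to π, so their mean is `π/N`. -/
theorem Chain.le_sum_half (hp : Chain N p Y) (hN : 1 ≤ N) {T : ℝ → ℝ}
    (hT : ConvexOn ℝ (Icc 0 Real.pi) T) :
    N * T (Real.pi / N) ≤ ∑ j ∈ Finset.range N, T (half p j) := by
  have hN0 : (0 : ℝ) < N := by exact_mod_cast hN
  have h := hT.map_sum_le (t := Finset.range N) (w := fun _ => (N : ℝ)⁻¹) (p := half p)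
    (fun _ _ => by positivity) (by simp [hN0.ne'])
    fun j hj => hp.half_mem_Icc hN (Finset.mem_range.1 hj).le
  simp only [smul_eq_mul, ← Finset.mul_sum, hp.sum_half] at h
  rw [← div_eq_inv_mul, ← div_eq_inv_mul, le_div_iff₀ hN0] at h
  linarith

theorem Chain.lt_sum_half (hp : Chain N p Y) (hN : 1 ≤ N) {T : ℝ → ℝ}
    (hT : StrictConvexOn ℝ (Icc 0 Real.pi) T) (hne : ∃ j < N, half p j ≠ Real.pi / N) :
    N * T (Real.pi / N) < ∑ j ∈ Finset.range N, T (half p j) := by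
  have hN0 : (0 : ℝ) < N := by exact_mod_cast hN
  have h := (hT.map_sum_lt_iff_of_pos' (t := Finset.range N) (w := fun _ => (N : ℝ)⁻¹)
    (p := half p) (fun _ _ => by positivity) (by simp [hN0.ne'])
    fun j hj => hp.half_mem_Icc hN (Finset.mem_range.1 hj).le).2
  simp only [smul_eq_mul, ← Finset.mul_sum, hp.sum_half] at h
  rw [← div_eq_inv_mul, ← div_eq_inv_mul, lt_div_iff₀ hN0] at h
  obtain ⟨j, hj, hjne⟩ := hne
  have := h ⟨j, Finset.mem_range.2 hj, hjne⟩
  linarith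

end

/-! ### Enumerating a configuration. -/

theorem exists_chain {N : ℕ} (hN : 1 ≤ N) {Y : Finset ℝ}
    (hY : (Y : Set ℝ) ⊆ Ioo 0 (2 * Real.pi)) (hc : Y.card = N) : ∃ p, Chain N p Y := by
  let e := Y.orderEmbOfFin hc
  have hmem : ∀ i, e i ∈ Ioo 0 (2 * Real.pi) := fun i => hY (Y.orderEmbOfFin_mem hc i)
  -- `Fin N` counts from 0, the chain from 1. Indices `0` and `N + 1` hold the last point moved back
  -- and the first moved forward by one period.
  let p : ℕ → ℝ := fun j =>
    if h : 1 ≤ j ∧ j ≤ N then e ⟨j - 1, by omega⟩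
    else if j = 0 then e ⟨N - 1, by omega⟩ - 2 * Real.pi else e ⟨0, by omega⟩ + 2 * Real.pi
  have h0 : p 0 = e ⟨N - 1, by omega⟩ - 2 * Real.pi := by simp [p]
  have hl : p (N + 1) = e ⟨0, by omega⟩ + 2 * Real.pi := by simp [p]
  have hj : ∀ j, (h : 1 ≤ j ∧ j ≤ N) → p j = e ⟨j - 1, by omega⟩ := fun j h => by simp [p, h]
  refine ⟨p, ⟨fun j hjN => ?_, fun j h => ?_, ?_, ?_, ?_⟩⟩
  · rcases Nat.eq_zero_or_pos j with rfl | h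
    · rw [h0, hj _ ⟨le_rfl, hN⟩]
      have h1 := (hmem ⟨N - 1, by omega⟩).2
      have h2 := (hmem ⟨0 + 1 - 1, by omega⟩).1
      linarith
    · rcases hjN.eq_or_lt with rfl | h'
      · rw [hl, hj _ ⟨hN, le_rfl⟩]
        have h1 := (hmem ⟨j - 1, by omega⟩).2
        have h2 := (hmem ⟨0, by omega⟩).1
        linarith
      · rw [hj _ ⟨h, hjN⟩, hj _ ⟨by omega, h'⟩]
        exact e.strictMono (by simp only [Fin.mk_lt_mk]; omega)
  · rw [hj j (Finset.mem_Icc.1 h)]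
    exact hmem _
  · rw [h0, hj N ⟨hN, le_rfl⟩]; ring
  · rw [hl, hj 1 ⟨le_rfl, hN⟩]
  · ext y
    rw [← Finset.mem_coe (s := Y), ← Y.range_orderEmbOfFin hc]
    simp only [Finset.mem_image, Finset.mem_Icc, mem_range]
    constructor
    · rintro ⟨j, h, rfl⟩
      exact ⟨_, (hj j h).symm⟩
    · rintro ⟨i, rfl⟩
      refine ⟨i + 1, ⟨by omega, by omega⟩, ?_⟩
      rw [hj _ ⟨by omega, by omega⟩]
      rfl

theorem chain_equidistant {N : ℕ} (hN : 1 ≤ N) :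
    Chain N (fun j => Real.pi / N * (2 * j - 1)) (equidistant N) := by
  have hN0 : (0 : ℝ) < N := by exact_mod_cast hN
  have hπ : 0 < Real.pi / N := by positivity
  have hπN : Real.pi / N * N = Real.pi := by field_simp
  refine ⟨fun j _ => ?_, fun j hj => ?_, ?_, ?_, rfl⟩
  · push_cast
    nlinarith
  · obtain ⟨h1, h2⟩ := Finset.mem_Icc.1 hj
    have h1' : (1 : ℝ) ≤ j := by exact_mod_cast h1
    have h2' : (j : ℝ) ≤ N := by exact_mod_cast h2
    exact ⟨mul_pos hπ (by linarith), by nlinarith⟩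
  · push_cast
    linarith
  · push_cast
    linarith

/-! ### Congruence to the equidistant set means equal gaps. -/

section

variable {N : ℕ} {p : ℕ → ℝ} {Y : Finset ℝ}

theorem half_equidistant (N j : ℕ) :
    half (fun j => Real.pi / N * (2 * j - 1)) j = Real.pi / N := by
  rw [half]; push_cast; ring

theorem coe_image_chain (hp : Chain N p Y) :
    (fun y : ℝ => (y : AddCircle (2 * Real.pi))) '' (Y : Set ℝ) =
      (fun j => (p j : AddCircle (2 * Real.pi))) '' Icc 1 N := by
  rw [← hp.image_eq, Finset.coe_image, Finset.coe_Icc, image_image]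

/-- Equal gaps make the points an arithmetic progression with step `2π/N`, and a rotation carries it
onto the equidistant one. -/
theorem Chain.congruent_of_half (hp : Chain N p Y) (hN : 1 ≤ N)
    (h : ∀ j < N, half p j = Real.pi / N) : Congruent Y (equidistant N) := by
  have hpj : ∀ j ≤ N, p j = p 0 + 2 * (Real.pi / N) * j := by
    intro j
    induction j with
    | zero => simp
    | succ k ih =>
      intro hk
      have h1 := h k hk
      rw [half] at h1
      have h2 := ih (by omega)
      push_cast
      linarith
  refine ⟨IsometryEquiv.addRight ((-(Real.pi / N) - p 0 : ℝ) : AddCircle (2 * Real.pi)), ?_⟩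
  rw [coe_image_chain hp, coe_image_chain (chain_equidistant hN), image_image]
  refine image_congr fun j hj => ?_
  rw [IsometryEquiv.addRight_apply, ← AddCircle.coe_add, hpj j hj.2]
  congr 1
  ring

/-- Modulo `2π` the difference is `2π/N` times an integer congruent to `i - j` mod `N`, which is
nonzero because `0 < |i - j| < N`. -/
theorem le_dist_equidistant {i j : ℕ} (hi : i ∈ Icc 1 N) (hj : j ∈ Icc 1 N) (hij : i ≠ j) :
    2 * (Real.pi / N) ≤ dist ((Real.pi / N * (2 * i - 1) : ℝ) : AddCircle (2 * Real.pi))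
      ((Real.pi / N * (2 * j - 1) : ℝ) : AddCircle (2 * Real.pi)) := by
  have hN0 : (0 : ℝ) < N := by exact_mod_cast hi.1.trans hi.2
  rw [dist_eq_norm, ← AddCircle.coe_sub, AddCircle.norm_eq]
  set r : ℤ := round ((2 * Real.pi)⁻¹ * (Real.pi / N * (2 * i - 1) - Real.pi / N * (2 * j - 1)))
  have hz : (i : ℤ) - j - r * N ≠ 0 := by
    intro h0
    have hd : (N : ℤ) ∣ i - j := ⟨r, by linarith⟩
    have := Int.eq_zero_of_abs_lt_dvd hd (by
      rw [abs_lt]; constructor <;> linarith [hi.1, hi.2, hj.1, hj.2])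
    omega
  have h1 : (1 : ℝ) ≤ |(((i : ℤ) - j - r * N : ℤ) : ℝ)| := by exact_mod_cast Int.one_le_abs hz
  have e : Real.pi / N * (2 * i - 1) - Real.pi / N * (2 * j - 1) - r * (2 * Real.pi) =
      2 * (Real.pi / N) * ((i : ℤ) - j - r * N : ℤ) := by
    push_cast
    field_simp
    ring
  rw [e, abs_mul, abs_of_pos (by positivity : (0 : ℝ) < 2 * (Real.pi / N))]
  exact le_mul_of_one_le_right (by positivity) h1

/-- Only distances are used, so isometries need no classification: distinct points of `Y` are at
least `2π/N` apart, hence so is every gap, and the total length `2π` forces equality. -/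
theorem Chain.half_of_congruent (hp : Chain N p Y) (hN : 2 ≤ N)
    (h : Congruent Y (equidistant N)) : ∀ j < N, half p j = Real.pi / N := by
  have hN1 : 1 ≤ N := by omega
  have : Fact (0 < 2 * Real.pi) := ⟨by positivity⟩
  obtain ⟨e, he⟩ := h
  rw [coe_image_chain hp, coe_image_chain (chain_equidistant hN1), image_image] at he
  have hinj : ∀ i ∈ Icc 1 N, ∀ j ∈ Icc 1 N, i < j →
      (p i : AddCircle (2 * Real.pi)) ≠ (p j : AddCircle (2 * Real.pi)) := by
    intro i hi j hj hij heq
    rw [AddCircle.coe_eq_coe_iff_of_mem_Ico (p := 2 * Real.pi) (a := 0)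
      (by simpa using Ioo_subset_Ico_self (hp.mem_Ioo i (Finset.mem_Icc.2 hi)))
      (by simpa using Ioo_subset_Ico_self (hp.mem_Ioo j (Finset.mem_Icc.2 hj)))] at heq
    exact absurd heq (hp.strictMono hij (hj.2.trans (Nat.le_succ N))).ne
  have hdist : ∀ i ∈ Icc 1 N, ∀ j ∈ Icc 1 N, i < j → 2 * (Real.pi / N) ≤
      dist (p i : AddCircle (2 * Real.pi)) (p j : AddCircle (2 * Real.pi)) := by
    intro i hi j hj hij
    obtain ⟨i', hi', hei⟩ := he.subset (mem_image_of_mem _ hi)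
    obtain ⟨j', hj', hej⟩ := he.subset (mem_image_of_mem _ hj)
    simp only at hei hej
    rw [← e.dist_eq, ← hei, ← hej]
    refine le_dist_equidistant hi' hj' ?_
    rintro rfl
    exact hinj i hi j hj hij (e.injective (hei.symm.trans hej))
  have hle : ∀ x y : ℝ, x ≤ y →
      dist (x : AddCircle (2 * Real.pi)) (y : AddCircle (2 * Real.pi)) ≤ y - x := by
    intro x y hxy
    rw [dist_comm, dist_eq_norm, ← AddCircle.coe_sub]
    exact QuotientAddGroup.norm_mk_le_norm.trans_eq (by
      rw [Real.norm_eq_abs, abs_of_nonneg (sub_nonneg.2 hxy)])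
  have hge : ∀ j ∈ Icc 1 N, Real.pi / N ≤ half p j := by
    intro j hj
    rw [half]
    rcases hj.2.eq_or_lt with rfl | hlt
    -- The wrap-around gap joins the last point to the first; they are distinct because `2 ≤ N`.
    · have h1 := hdist 1 ⟨le_rfl, hN1⟩ j hj hN
      have h2 := hle (p j) (p (j + 1)) (hp.lt_succ j le_rfl).le
      rw [hp.wrap_first, AddCircle.coe_add_period, dist_comm] at h2
      rw [hp.wrap_first]
      linarith
    · have h1 := hdist j hj (j + 1) ⟨by omega, hlt⟩ (by omega)
      have h2 := hle (p j) (p (j + 1)) (hp.lt_succ j hj.2).le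
      linarith
  have hge' : ∀ j ∈ Finset.range N, Real.pi / N ≤ half p j := by
    intro j hj
    rcases Nat.eq_zero_or_pos j with rfl | h0
    · rw [← hp.half_last]
      exact hge N ⟨hN1, le_rfl⟩
    · exact hge j ⟨h0, (Finset.mem_range.1 hj).le⟩
  have hsum : ∑ _j ∈ Finset.range N, Real.pi / N = ∑ j ∈ Finset.range N, half p j := by
    have hN0 : (N : ℝ) ≠ 0 := by positivity
    rw [hp.sum_half, Finset.sum_const, Finset.card_range, nsmul_eq_mul]
    field_simp
  intro j hj
  exact ((Finset.sum_eq_sum_iff_of_le hge').1 hsum j (Finset.mem_range.2 hj)).symm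

end

/-! ### The quadratic form and Sobolev estimates. -/

/-- The squared norm of `f` in `L²(I)`. -/
def sqNorm (f : ℝ → ℂ) : ℝ := ∫ x in Ioo 0 (2 * Real.pi), ‖f x‖ ^ 2

/-- The quadratic form `q_{α,Y}(ψ) = ‖ψ'‖² + α ∑_{y ∈ Y} |ψ(y)|²`. -/
def energy (α : ℝ) (Y : Finset ℝ) (ψ dψ : ℝ → ℂ) : ℝ :=
  sqNorm dψ + α * ∑ y ∈ Y, ‖ψ y‖ ^ 2

theorem sqNorm_nonneg (f : ℝ → ℂ) : 0 ≤ sqNorm f := integral_nonneg fun _ => by positivity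

theorem integrable_norm_sq {f : ℝ → ℂ} (hf : MemLp f 2 loopMeasure) :
    Integrable (fun x => ‖f x‖ ^ 2) loopMeasure :=
  (memLp_two_iff_integrable_sq_norm hf.1).1 hf

theorem integral_conj_mul_self (f : ℝ → ℂ) :
    ∫ x in Ioo 0 (2 * Real.pi), conj (f x) * f x = (sqNorm f : ℂ) := by
  rw [sqNorm, ← integral_complex_ofReal]
  refine integral_congr_ae (.of_forall fun x => ?_)
  simp [Complex.conj_mul']

theorem form_self (α : ℝ) (Y : Finset ℝ) (ψ dψ : ℝ → ℂ) :
    form α Y ψ dψ ψ dψ = (energy α Y ψ dψ : ℂ) := by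
  rw [form, integral_conj_mul_self, energy]
  push_cast
  simp [Complex.conj_mul']

theorem norm_add_smul_sq (z v c : ℂ) :
    ‖z + c * v‖ ^ 2 = ‖z‖ ^ 2 + 2 * (conj c * (conj v * z)).re + ‖c‖ ^ 2 * ‖v‖ ^ 2 := by
  simp only [← Complex.normSq_eq_norm_sq, Complex.normSq_apply, Complex.add_re, Complex.add_im,
    Complex.mul_re, Complex.mul_im, Complex.conj_re, Complex.conj_im]
  ring

theorem sqNorm_add_smul {f g : ℝ → ℂ} (hf : MemLp f 2 loopMeasure) (hg : MemLp g 2 loopMeasure)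
    (c : ℂ) : sqNorm (f + c • g) = sqNorm f +
      2 * (conj c * ∫ x in Ioo 0 (2 * Real.pi), conj (g x) * f x).re + ‖c‖ ^ 2 * sqNorm g := by
  have hi := (integrable_conj_mul hg hf).const_mul (conj c)
  have hre : Integrable (fun x => (conj c * (conj (g x) * f x)).re) loopMeasure := hi.re
  simp only [sqNorm, Pi.add_apply, Pi.smul_apply, smul_eq_mul, norm_add_smul_sq]
  rw [integral_add _ ((integrable_norm_sq hg).const_mul _),
    integral_add (integrable_norm_sq hf) (hre.const_mul 2), integral_const_mul,
    integral_const_mul, ← integral_const_mul (conj c)]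
  · congr 3
    exact integral_re hi
  · exact (integrable_norm_sq hf).add (hre.const_mul 2)

/-- Its linear term is the first variation, from which the Euler-Lagrange equation comes; `c = ±1`
gives the parallelogram law. -/
theorem energy_add_smul (α : ℝ) (Y : Finset ℝ) {ψ dψ φ dφ : ℝ → ℂ} (h : IsPeriodicH1 ψ dψ)
    (k : IsPeriodicH1 φ dφ) (c : ℂ) :
    energy α Y (ψ + c • φ) (dψ + c • dφ) = energy α Y ψ dψ +
      2 * (conj c * form α Y φ dφ ψ dψ).re + ‖c‖ ^ 2 * energy α Y φ dφ := by
  have e : (conj c * form α Y φ dφ ψ dψ).re =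
      (conj c * ∫ x in Ioo 0 (2 * Real.pi), conj (dφ x) * dψ x).re +
        α * ∑ y ∈ Y, (conj c * (conj (φ y) * ψ y)).re := by
    rw [form, mul_add, Complex.add_re, ← Complex.re_sum, ← Finset.mul_sum, mul_left_comm,
      Complex.re_ofReal_mul]
  rw [e, energy, energy, energy, sqNorm_add_smul h.memLp_deriv k.memLp_deriv]
  simp only [Pi.add_apply, Pi.smul_apply, smul_eq_mul, norm_add_smul_sq, Finset.sum_add_distrib,
    ← Finset.mul_sum]
  ring

theorem sqNorm_smul (c : ℂ) (f : ℝ → ℂ) : sqNorm (c • f) = ‖c‖ ^ 2 * sqNorm f := by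
  simp only [sqNorm, Pi.smul_apply, norm_smul, mul_pow]
  rw [integral_const_mul]

theorem energy_smul (α : ℝ) (Y : Finset ℝ) (c : ℂ) (ψ dψ : ℝ → ℂ) :
    energy α Y (c • ψ) (c • dψ) = ‖c‖ ^ 2 * energy α Y ψ dψ := by
  simp only [energy, sqNorm_smul, Pi.smul_apply, norm_smul, mul_pow, ← Finset.mul_sum]
  ring

theorem IsPeriodicH1.sub {ψ dψ χ dχ : ℝ → ℂ} (h : IsPeriodicH1 ψ dψ) (k : IsPeriodicH1 χ dχ) :
    IsPeriodicH1 (ψ - χ) (dψ - dχ) := by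
  simpa [sub_eq_add_neg] using h.add (k.smul (-1))

theorem sqNorm_parallelogram {f g : ℝ → ℂ} (hf : MemLp f 2 loopMeasure)
    (hg : MemLp g 2 loopMeasure) :
    sqNorm (f + g) + sqNorm (f - g) = 2 * sqNorm f + 2 * sqNorm g := by
  have h1 := sqNorm_add_smul hf hg 1
  have h2 := sqNorm_add_smul hf hg (-1)
  simp only [one_smul, neg_smul, ← sub_eq_add_neg, map_neg, map_one, norm_neg, norm_one, neg_mul,
    one_mul, Complex.neg_re] at h1 h2
  rw [h1, h2]
  ring

theorem energy_parallelogram (α : ℝ) (Y : Finset ℝ) {ψ dψ φ dφ : ℝ → ℂ} (h : IsPeriodicH1 ψ dψ)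
    (k : IsPeriodicH1 φ dφ) : energy α Y (ψ + φ) (dψ + dφ) + energy α Y (ψ - φ) (dψ - dφ) =
      2 * energy α Y ψ dψ + 2 * energy α Y φ dφ := by
  have h1 := energy_add_smul α Y h k 1
  have h2 := energy_add_smul α Y h k (-1)
  simp only [one_smul, neg_smul, ← sub_eq_add_neg, map_neg, map_one, norm_neg, norm_one, neg_mul,
    one_mul, Complex.neg_re] at h1 h2
  rw [h1, h2]
  ring

/-- The Cauchy-Schwarz inequality for the integral over a subinterval. -/
theorem norm_integral_sq_le {f : ℝ → ℂ} (hf : MemLp f 2 loopMeasure) {a b : ℝ} (ha : 0 ≤ a)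
    (hab : a ≤ b) (hb : b ≤ 2 * Real.pi) :
    ‖∫ x in a..b, f x‖ ^ 2 ≤ (b - a) * sqNorm f := by
  rcases hab.eq_or_lt with rfl | hlt
  · simp
  have hi : IntervalIntegrable f volume 0 (2 * Real.pi) := by
    rw [intervalIntegrable_iff_integrableOn_Ioo_of_le (by positivity)]
    exact hf.integrable (by norm_num)
  have hi1 : IntervalIntegrable (fun x => ‖f x‖) volume a b :=
    (hi.mono_set (IsPeriodicH1.subset_uIcc ha hab hb)).norm
  have hi2 := intervalIntegrable_norm_sq hf ha hab hb
  have hle : ‖∫ x in a..b, f x‖ ≤ ∫ x in a..b, ‖f x‖ :=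
    intervalIntegral.norm_integral_le_integral_norm hab
  have hsq : ∫ x in a..b, ‖f x‖ ^ 2 ≤ sqNorm f := by
    rw [intervalIntegral.integral_of_le hab, sqNorm, integral_Ioc_eq_integral_Ioo]
    exact setIntegral_mono_set (integrable_norm_sq hf) (.of_forall fun _ => by positivity)
      (Ioo_subset_Ioo ha hb).eventuallyLE
  set s := ∫ x in a..b, ‖f x‖
  -- Cauchy-Schwarz as nonnegativity of the variance of `‖f‖` about its mean.
  have h0 : 0 ≤ ∫ x in a..b, (‖f x‖ - s / (b - a)) ^ 2 :=
    intervalIntegral.integral_nonneg hab fun _ _ => sq_nonneg _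
  have e : ∫ x in a..b, (‖f x‖ - s / (b - a)) ^ 2 =
      (∫ x in a..b, ‖f x‖ ^ 2) - s ^ 2 / (b - a) := by
    have hc : ∀ x, (‖f x‖ - s / (b - a)) ^ 2 =
        ‖f x‖ ^ 2 - 2 * (s / (b - a)) * ‖f x‖ + (s / (b - a)) ^ 2 := fun x => by ring
    simp only [hc]
    rw [intervalIntegral.integral_add (hi2.sub (hi1.const_mul _)) intervalIntegrable_const,
      intervalIntegral.integral_sub hi2 (hi1.const_mul _), intervalIntegral.integral_const_mul,
      intervalIntegral.integral_const, smul_eq_mul]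
    have : b - a ≠ 0 := (sub_pos.2 hlt).ne'
    field_simp
    ring
  rw [e, sub_nonneg, div_le_iff₀ (sub_pos.2 hlt)] at h0
  calc ‖∫ x in a..b, f x‖ ^ 2 ≤ s ^ 2 := pow_le_pow_left₀ (norm_nonneg _) hle 2
    _ ≤ (b - a) * sqNorm f := by
      rw [mul_comm]
      exact h0.trans (mul_le_mul_of_nonneg_right hsq (sub_pos.2 hlt).le)

theorem IsPeriodicH1.norm_sub_sq_le {ψ dψ : ℝ → ℂ} (h : IsPeriodicH1 ψ dψ) {x y : ℝ}
    (hx : x ∈ Icc 0 (2 * Real.pi)) (hy : y ∈ Icc 0 (2 * Real.pi)) :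
    ‖ψ x - ψ y‖ ^ 2 ≤ |x - y| * sqNorm dψ := by
  wlog hyx : y ≤ x generalizing x y
  · rw [norm_sub_rev, abs_sub_comm]
    exact this hy hx (le_of_not_ge hyx)
  have h1 : IntervalIntegrable dψ volume 0 x :=
    h.intervalIntegrable.mono_set (subset_uIcc le_rfl hx.1 hx.2)
  have h2 : IntervalIntegrable dψ volume 0 y :=
    h.intervalIntegrable.mono_set (subset_uIcc le_rfl hy.1 hy.2)
  rw [h.eq_primitive x hx, h.eq_primitive y hy, add_sub_add_left_eq_sub,
    intervalIntegral.integral_interval_sub_left h1 h2, abs_of_nonneg (sub_nonneg.2 hyx)]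
  exact norm_integral_sq_le h.memLp_deriv hy.1 hyx hx.2

/-- Compare `ψ x` with `ψ t` and average over `t` in `(0, 2π)`. -/
theorem IsPeriodicH1.norm_sq_le {ψ dψ : ℝ → ℂ} (h : IsPeriodicH1 ψ dψ) {x : ℝ}
    (hx : x ∈ Icc 0 (2 * Real.pi)) :
    ‖ψ x‖ ^ 2 ≤ sqNorm ψ / Real.pi + 4 * Real.pi * sqNorm dψ := by
  have hpi := Real.pi_pos
  have hpt : ∀ t ∈ Ioo 0 (2 * Real.pi),
      ‖ψ x‖ ^ 2 ≤ 2 * ‖ψ t‖ ^ 2 + 2 * (2 * Real.pi * sqNorm dψ) := by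
    intro t ht
    have h1 := h.norm_sub_sq_le hx (Ioo_subset_Icc_self ht)
    have h2 : |x - t| * sqNorm dψ ≤ 2 * Real.pi * sqNorm dψ := by
      refine mul_le_mul_of_nonneg_right ?_ (sqNorm_nonneg _)
      rw [abs_le]
      constructor <;> linarith [hx.1, hx.2, ht.1, ht.2]
    have h3 : ‖ψ x‖ ≤ ‖ψ x - ψ t‖ + ‖ψ t‖ := by simpa using norm_add_le (ψ x - ψ t) (ψ t)
    nlinarith [sq_nonneg (‖ψ x - ψ t‖ - ‖ψ t‖), norm_nonneg (ψ x)]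
  have hi := setIntegral_mono_on (μ := volume) (integrableOn_const measure_Ioo_lt_top.ne)
    (((integrable_norm_sq h.memLp).const_mul 2).add
      (integrable_const (2 * (2 * Real.pi * sqNorm dψ)))) measurableSet_Ioo hpt
  simp only [Pi.add_apply] at hi
  rw [integral_add ((integrable_norm_sq h.memLp).const_mul 2) (integrable_const _),
    integral_const_mul, setIntegral_const, setIntegral_const] at hi
  simp only [measureReal_def, Real.volume_Ioo, sub_zero, smul_eq_mul,
    ENNReal.toReal_ofReal Real.two_pi_pos.le] at hi
  change _ ≤ 2 * sqNorm ψ + _ at hi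
  rw [div_add' _ _ _ hpi.ne', le_div_iff₀ hpi]
  nlinarith

/-- For weak coupling, the form controls the norm of the derivative. -/
theorem IsPeriodicH1.sqNorm_deriv_le {ψ dψ : ℝ → ℂ} (h : IsPeriodicH1 ψ dψ) {α : ℝ}
    {Y : Finset ℝ} (hY : (Y : Set ℝ) ⊆ Ioo 0 (2 * Real.pi))
    (hα : |α| * (Y.card * (8 * Real.pi)) ≤ 1) :
    sqNorm dψ ≤ 2 * (energy α Y ψ dψ + sqNorm ψ) := by
  have hpi := Real.pi_gt_three
  have hs : ∑ y ∈ Y, ‖ψ y‖ ^ 2 ≤ Y.card * (sqNorm ψ / Real.pi + 4 * Real.pi * sqNorm dψ) := by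
    rw [← nsmul_eq_mul]
    exact Finset.sum_le_card_nsmul _ _ _ fun y hy =>
      h.norm_sq_le (Ioo_subset_Icc_self (hY hy))
  have hs0 : 0 ≤ ∑ y ∈ Y, ‖ψ y‖ ^ 2 := Finset.sum_nonneg fun _ _ => by positivity
  have h1 : -(α * ∑ y ∈ Y, ‖ψ y‖ ^ 2) ≤ |α| * ∑ y ∈ Y, ‖ψ y‖ ^ 2 := by
    rw [← neg_mul]
    exact mul_le_mul_of_nonneg_right (neg_le_abs α) hs0
  have h2 := mul_le_mul_of_nonneg_left hs (abs_nonneg α)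
  have hX : 0 ≤ sqNorm ψ / (8 * Real.pi ^ 2) + sqNorm dψ / 2 := by
    have := sqNorm_nonneg ψ
    have := sqNorm_nonneg dψ
    positivity
  -- The constant `8π` is twice the `4π` of the pointwise bound, so the delta terms absorb at most
  -- half of `‖ψ'‖²`.
  have h3 := mul_le_mul_of_nonneg_right hα hX
  have e : |α| * (Y.card * (8 * Real.pi)) * (sqNorm ψ / (8 * Real.pi ^ 2) + sqNorm dψ / 2) =
      |α| * (Y.card * (sqNorm ψ / Real.pi + 4 * Real.pi * sqNorm dψ)) := by
    field_simp
    ring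
  have h4 : sqNorm ψ / (8 * Real.pi ^ 2) ≤ sqNorm ψ :=
    div_le_self (sqNorm_nonneg _) (by nlinarith)
  rw [energy]
  linarith

/-! ### Compactness and existence of a minimizer. -/

open Filter Topology in
/-- The Arzelà-Ascoli theorem for functions on `[0, 2π]` with a common Hölder bound. -/
theorem exists_subseq_tendstoUniformlyOn {ψ : ℕ → ℝ → ℂ} {K M : ℝ}
    (hM : ∀ k, ∀ x ∈ Icc 0 (2 * Real.pi), ‖ψ k x‖ ≤ M)
    (hK : ∀ k, ∀ x ∈ Icc 0 (2 * Real.pi), ∀ y ∈ Icc 0 (2 * Real.pi),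
      ‖ψ k x - ψ k y‖ ^ 2 ≤ |x - y| * K) :
    ∃ (n : ℕ → ℕ) (g : ℝ → ℂ), StrictMono n ∧
      TendstoUniformlyOn (fun k => ψ (n k)) g atTop (Icc 0 (2 * Real.pi)) := by
  let I := Icc (0 : ℝ) (2 * Real.pi)
  have h0 : (0 : ℝ) ≤ 2 * Real.pi := by positivity
  have hmod : ∀ f : I → ℂ, (∀ x y : I, ‖f x - f y‖ ^ 2 ≤ |(x : ℝ) - y| * K) → ∀ x y : I,
      dist (f x) (f y) ≤ √(|(x : ℝ) - y| * K) := fun f hf x y => by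
    rw [dist_eq_norm]
    exact Real.le_sqrt_of_sq_le (hf x y)
  have hlim : ∀ x : I, Tendsto (fun y : I => √(|(x : ℝ) - y| * K)) (𝓝 x) (𝓝 0) := by
    intro x
    have hc : Continuous fun y : I => √(|(x : ℝ) - y| * K) := by fun_prop
    simpa using hc.tendsto x
  have hcont : ∀ f : I → ℂ, (∀ x y : I, ‖f x - f y‖ ^ 2 ≤ |(x : ℝ) - y| * K) →
      Continuous f := fun f hf => continuous_iff_continuousAt.2 fun x =>
    tendsto_iff_dist_tendsto_zero.2 <| squeeze_zero (fun _ => dist_nonneg)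
      (fun y => by rw [dist_comm]; exact hmod f hf x y) (hlim x)
  have hr : ∀ k, ∀ x y : I, ‖ψ k x - ψ k y‖ ^ 2 ≤ |(x : ℝ) - y| * K :=
    fun k x y => hK k x x.2 y y.2
  let F : ℕ → BoundedContinuousFunction I ℂ := fun k =>
    BoundedContinuousFunction.mkOfCompact ⟨fun x : I => ψ k x, hcont _ (hr k)⟩
  have hcomp : IsCompact (closure (range F)) := by
    refine BoundedContinuousFunction.arzela_ascoli (Metric.closedBall 0 M)
      (isCompact_closedBall _ _) _ ?_ ?_
    · rintro _ x ⟨k, rfl⟩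
      exact mem_closedBall_zero_iff.2 (hM k x x.2)
    · refine fun x => Metric.equicontinuousAt_of_continuity_modulus _ (hlim x) _
        (.of_forall fun y => ?_)
      rintro ⟨_, k, rfl⟩
      exact hmod _ (hr k) x y
  obtain ⟨f, -, n, hn, hf⟩ := hcomp.tendsto_subseq fun k => subset_closure (mem_range_self k)
  refine ⟨n, IccExtend h0 f, hn, ?_⟩
  have hu := BoundedContinuousFunction.tendsto_iff_tendstoUniformly.1 hf
  rw [Metric.tendstoUniformlyOn_iff]
  rw [Metric.tendstoUniformly_iff] at hu
  intro ε hε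
  filter_upwards [hu ε hε] with k hk x hx
  rw [IccExtend_of_mem h0 _ hx]
  exact hk ⟨x, hx⟩

theorem norm_toLp_sq {f : ℝ → ℂ} (hf : MemLp f 2 loopMeasure) :
    ‖hf.toLp f‖ ^ 2 = sqNorm f := by
  have h := inner_self_eq_norm_sq_to_K (𝕜 := ℂ) (hf.toLp f)
  rw [L2.inner_def] at h
  have e : ∫ x, inner ℂ (hf.toLp f x) (hf.toLp f x) ∂loopMeasure = (sqNorm f : ℂ) := by
    rw [← integral_conj_mul_self]
    refine integral_congr_ae ?_
    filter_upwards [hf.coeFn_toLp] with x hx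
    rw [hx, RCLike.inner_apply, mul_comm]
  rw [e] at h
  exact Complex.ofReal_injective (by rw [h]; simp)

open Filter Topology in
/-- Uniform limits of periodic `H¹` functions whose derivatives form a Cauchy sequence. -/
theorem exists_limit {ψ dψ : ℕ → ℝ → ℂ} (h : ∀ k, IsPeriodicH1 (ψ k) (dψ k)) {g : ℝ → ℂ}
    (hg : TendstoUniformlyOn ψ g atTop (Icc 0 (2 * Real.pi)))
    (hc : ∀ ε > 0, ∃ K, ∀ i ≥ K, ∀ j ≥ K, sqNorm (dψ i - dψ j) < ε) :
    ∃ dg, IsPeriodicH1 g dg ∧ Tendsto (fun k => sqNorm (dψ k)) atTop (𝓝 (sqNorm dg)) ∧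
      Tendsto (fun k => sqNorm (ψ k)) atTop (𝓝 (sqNorm g)) := by
  have hpt : ∀ x ∈ Icc 0 (2 * Real.pi), Tendsto (fun k => ψ k x) atTop (𝓝 (g x)) :=
    fun x hx => hg.tendsto_at hx
  have h0 : (0 : ℝ) ∈ Icc 0 (2 * Real.pi) := ⟨le_rfl, by positivity⟩
  have h2π : 2 * Real.pi ∈ Icc 0 (2 * Real.pi) := ⟨by positivity, le_rfl⟩
  have hcs : CauchySeq fun k => (h k).memLp_deriv.toLp (dψ k) := by
    rw [Metric.cauchySeq_iff]
    intro ε hε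
    obtain ⟨K, hK⟩ := hc (ε ^ 2) (by positivity)
    refine ⟨K, fun i hi j hj => ?_⟩
    have := hK i hi j hj
    rw [← norm_toLp_sq ((h i).memLp_deriv.sub (h j).memLp_deriv), MemLp.toLp_sub (h i).memLp_deriv
      (h j).memLp_deriv, ← dist_eq_norm] at this
    exact lt_of_pow_lt_pow_left₀ 2 hε.le this
  -- Completeness of `L²` supplies the candidate for the derivative of `g`; that it is the
  -- derivative follows by passing to the limit in the primitives.
  obtain ⟨G, hG⟩ := cauchySeq_tendsto_of_complete hcs
  have hGm : MemLp G 2 loopMeasure := Lp.memLp G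
  have hGt : hGm.toLp G = G := Lp.toLp_coeFn G hGm
  have hdist : Tendsto (fun k => sqNorm (dψ k - G)) atTop (𝓝 0) := by
    have := (tendsto_iff_norm_sub_tendsto_zero.1 hG).pow 2
    rw [zero_pow two_ne_zero] at this
    refine this.congr fun k => ?_
    rw [← norm_toLp_sq ((h k).memLp_deriv.sub hGm),
      MemLp.toLp_sub (h k).memLp_deriv hGm, hGt]
  have hGi : ∀ {f : ℝ → ℂ}, MemLp f 2 loopMeasure → ∀ x ∈ Icc 0 (2 * Real.pi),
      IntervalIntegrable f volume 0 x := by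
    intro f hf x hx
    have : IntervalIntegrable f volume 0 (2 * Real.pi) := by
      rw [intervalIntegrable_iff_integrableOn_Ioo_of_le (by positivity)]
      exact hf.integrable (by norm_num)
    exact this.mono_set (IsPeriodicH1.subset_uIcc le_rfl hx.1 hx.2)
  have hprim : ∀ x ∈ Icc 0 (2 * Real.pi),
      Tendsto (fun k => ∫ t in (0 : ℝ)..x, dψ k t) atTop (𝓝 (∫ t in (0 : ℝ)..x, G t)) := by
    intro x hx
    rw [tendsto_iff_norm_sub_tendsto_zero]
    have hb : ∀ k, ‖(∫ t in (0 : ℝ)..x, dψ k t) - ∫ t in (0 : ℝ)..x, G t‖ ≤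
        √((x - 0) * sqNorm (dψ k - G)) := fun k => by
      rw [← intervalIntegral.integral_sub (hGi (h k).memLp_deriv x hx) (hGi hGm x hx)]
      exact Real.le_sqrt_of_sq_le
        (norm_integral_sq_le ((h k).memLp_deriv.sub hGm) le_rfl hx.1 hx.2)
    refine squeeze_zero (fun _ => norm_nonneg _) hb ?_
    simpa using (hdist.const_mul (x - 0)).sqrt
  have hH1 : IsPeriodicH1 g G := by
    refine ⟨hGm, fun x hx => ?_, ?_⟩
    · refine tendsto_nhds_unique (hpt x hx) (((hpt 0 h0).add (hprim x hx)).congr fun k => ?_)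
      exact ((h k).eq_primitive x hx).symm
    · exact tendsto_nhds_unique (hpt _ h2π) ((hpt 0 h0).congr fun k => (h k).periodic.symm)
  refine ⟨G, hH1, ?_, ?_⟩
  · have := (hG.norm).pow 2
    rw [← hGt, norm_toLp_sq hGm] at this
    exact this.congr fun k => norm_toLp_sq _
  · obtain ⟨M, hM⟩ := isCompact_Icc.exists_bound_of_continuousOn hH1.continuousOn
    have hb : ∀ᶠ k in atTop, ∀ᵐ x ∂loopMeasure, ‖‖ψ k x‖ ^ 2‖ ≤ (M + 1) ^ 2 := by
      filter_upwards [Metric.tendstoUniformlyOn_iff.1 hg 1 one_pos] with k hk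
      filter_upwards [ae_restrict_mem measurableSet_Ioo] with x hx
      have hx' := Ioo_subset_Icc_self hx
      have h1 := hk x hx'
      rw [dist_eq_norm, norm_sub_rev] at h1
      have h2 : ‖ψ k x‖ ≤ ‖ψ k x - g x‖ + ‖g x‖ := by simpa using norm_add_le (ψ k x - g x) (g x)
      rw [Real.norm_of_nonneg (by positivity)]
      exact pow_le_pow_left₀ (norm_nonneg _) (by linarith [hM x hx']) 2
    refine tendsto_integral_filter_of_dominated_convergence (fun _ => (M + 1) ^ 2)
      (.of_forall fun k => (h k).memLp.1.norm.pow 2) hb (integrable_const _) ?_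
    filter_upwards [ae_restrict_mem measurableSet_Ioo] with x hx
    exact ((hpt x (Ioo_subset_Icc_self hx)).norm).pow 2

theorem isPeriodicH1_const (c : ℂ) : IsPeriodicH1 (fun _ => c) 0 :=
  ⟨MemLp.zero, by simp, rfl⟩

open Filter Topology in
/-- For weak coupling, the quotient of the form by the squared norm attains its minimum. -/
theorem exists_minimizer {α : ℝ} {Y : Finset ℝ} (hY : (Y : Set ℝ) ⊆ Ioo 0 (2 * Real.pi))
    (hα : |α| * (Y.card * (8 * Real.pi)) ≤ 1) :
    ∃ E : ℝ, (∀ ψ dψ, IsPeriodicH1 ψ dψ → E * sqNorm ψ ≤ energy α Y ψ dψ) ∧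
      ∃ ψ dψ, IsPeriodicH1 ψ dψ ∧ sqNorm ψ = 1 ∧ energy α Y ψ dψ = E := by
  let S : Set ℝ := {e | ∃ ψ dψ, IsPeriodicH1 ψ dψ ∧ sqNorm ψ = 1 ∧ energy α Y ψ dψ = e}
  have hscale : ∀ ψ dψ, IsPeriodicH1 ψ dψ → 0 < sqNorm ψ →
      energy α Y ψ dψ / sqNorm ψ ∈ S := by
    intro ψ dψ h h0
    have hc : ‖(((√(sqNorm ψ))⁻¹ : ℝ) : ℂ)‖ ^ 2 = (sqNorm ψ)⁻¹ := by
      rw [Complex.norm_real, Real.norm_of_nonneg (by positivity), inv_pow, Real.sq_sqrt h0.le]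
    refine ⟨_, _, h.smul (((√(sqNorm ψ))⁻¹ : ℝ) : ℂ), ?_, ?_⟩
    · rw [sqNorm_smul, hc, inv_mul_cancel₀ h0.ne']
    · rw [energy_smul, hc, ← div_eq_inv_mul]
  have hne : S.Nonempty := by
    refine ⟨_, hscale _ _ (isPeriodicH1_const 1) ?_⟩
    simp [sqNorm, measureReal_def, Real.pi_pos.le, Real.pi_pos]
  have hlow : ∀ ψ dψ, IsPeriodicH1 ψ dψ → -sqNorm ψ ≤ energy α Y ψ dψ := by
    intro ψ dψ h
    linarith [h.sqNorm_deriv_le hY hα, sqNorm_nonneg dψ]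
  have hbdd : BddBelow S := by
    refine ⟨-1, ?_⟩
    rintro _ ⟨ψ, dψ, h, h1, rfl⟩
    rw [← h1]
    exact hlow ψ dψ h
  set E := sInf S
  have hE : ∀ ψ dψ, IsPeriodicH1 ψ dψ → E * sqNorm ψ ≤ energy α Y ψ dψ := by
    intro ψ dψ h
    rcases (sqNorm_nonneg ψ).eq_or_lt with h0 | h0
    · have := hlow ψ dψ h
      rw [← h0] at this ⊢
      simpa using this
    · exact (le_div_iff₀ h0).1 (csInf_le hbdd (hscale ψ dψ h h0))
  refine ⟨E, hE, ?_⟩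
  obtain ⟨e, -, he, heS⟩ := exists_seq_tendsto_sInf hne hbdd
  choose ψ₀ dψ₀ hψ₀ hn₀ he₀ using heS
  obtain ⟨B, hB⟩ := he.bddAbove_range
  have hD : ∀ k, sqNorm (dψ₀ k) ≤ 2 * (B + 1) := fun k => by
    have h1 := (hψ₀ k).sqNorm_deriv_le hY hα
    have h2 := hB (mem_range_self k)
    rw [he₀, hn₀] at h1
    linarith
  obtain ⟨n, g, hn, hg⟩ := exists_subseq_tendstoUniformlyOn (ψ := ψ₀) (K := 2 * (B + 1))
    (M := √(1 / Real.pi + 4 * Real.pi * (2 * (B + 1))))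
    (fun k x hx => Real.le_sqrt_of_sq_le (by
      have h1 := (hψ₀ k).norm_sq_le hx
      rw [hn₀] at h1
      exact h1.trans (by gcongr; exact hD k)))
    (fun k x hx y hy => ((hψ₀ k).norm_sub_sq_le hx hy).trans
      (mul_le_mul_of_nonneg_left (hD k) (abs_nonneg _)))
  set ψ : ℕ → ℝ → ℂ := fun k => ψ₀ (n k) with hψdef
  set dψ : ℕ → ℝ → ℂ := fun k => dψ₀ (n k)
  have hψ : ∀ k, IsPeriodicH1 (ψ k) (dψ k) := fun k => hψ₀ (n k)
  have hne1 : ∀ k, sqNorm (ψ k) = 1 := fun k => hn₀ (n k)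
  have hen : Tendsto (fun k => energy α Y (ψ k) (dψ k)) atTop (𝓝 E) := by
    refine (he.comp hn.tendsto_atTop).congr fun k => ?_
    exact (he₀ (n k)).symm
  have hcauchy : ∀ ε > 0, ∃ K, ∀ i ≥ K, ∀ j ≥ K, sqNorm (dψ i - dψ j) < ε := by
    intro ε hε
    -- If both energies are below `E + δ` and both functions are within `δ/2` of `g`, the
    -- parallelogram laws bound the energy of the difference by `4δ + E‖ψ_i - ψ_j‖²`, with `‖ψ_i -
    -- ψ_j‖² ≤ 2πδ²`. Coercivity then gives the expression here, so the derivatives converge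
    -- strongly.
    obtain ⟨δ, hδ, hδε⟩ : ∃ δ > 0, 2 * (4 * δ + (|E| + 1) * (δ ^ 2 * (2 * Real.pi))) < ε := by
      have hcont : Tendsto (fun δ : ℝ => 2 * (4 * δ + (|E| + 1) * (δ ^ 2 * (2 * Real.pi))))
          (𝓝[>] 0) (𝓝 0) := by
        have : Continuous fun δ : ℝ => 2 * (4 * δ + (|E| + 1) * (δ ^ 2 * (2 * Real.pi))) := by
          fun_prop
        simpa using (this.tendsto 0).mono_left nhdsWithin_le_nhds
      obtain ⟨δ, h1, h2⟩ := ((hcont.eventually_lt_const hε).and self_mem_nhdsWithin).exists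
      exact ⟨δ, h2, h1⟩
    have hev := (hen.eventually_lt_const (show E < E + δ by linarith)).and
      (Metric.tendstoUniformlyOn_iff.1 hg (δ / 2) (by positivity))
    obtain ⟨K, hK⟩ := eventually_atTop.1 hev
    refine ⟨K, fun i hi j hj => ?_⟩
    obtain ⟨hi1, hi2⟩ := hK i hi
    obtain ⟨hj1, hj2⟩ := hK j hj
    have hp1 := energy_parallelogram α Y (hψ i) (hψ j)
    have hp2 := sqNorm_parallelogram (hψ i).memLp (hψ j).memLp
    have hp3 := hE _ _ ((hψ i).add (hψ j))
    have hp4 := ((hψ i).sub (hψ j)).sqNorm_deriv_le hY hα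
    rw [hne1, hne1] at hp2
    have hsm : sqNorm (ψ i - ψ j) ≤ δ ^ 2 * (2 * Real.pi) := by
      have hle : ∀ x ∈ Ioo 0 (2 * Real.pi), ‖(ψ i - ψ j) x‖ ^ 2 ≤ δ ^ 2 := by
        intro x hx
        have h1 := hi2 x (Ioo_subset_Icc_self hx)
        have h2 := hj2 x (Ioo_subset_Icc_self hx)
        refine pow_le_pow_left₀ (norm_nonneg _) ?_ 2
        rw [Pi.sub_apply, ← dist_eq_norm]
        exact (dist_triangle_left _ _ (g x)).trans (by simpa [hψdef] using (add_lt_add h1 h2).le)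
      have := setIntegral_mono_on (μ := volume)
        (integrable_norm_sq ((hψ i).memLp.sub (hψ j).memLp))
        (integrableOn_const measure_Ioo_lt_top.ne) measurableSet_Ioo hle
      rw [setIntegral_const] at this
      simpa [sqNorm, measureReal_def, Real.pi_pos.le, mul_comm] using this
    have h5 : E * sqNorm (ψ i - ψ j) ≤ |E| * sqNorm (ψ i - ψ j) :=
      mul_le_mul_of_nonneg_right (le_abs_self E) (sqNorm_nonneg _)
    have h6 : E * sqNorm (ψ i + ψ j) = 4 * E - E * sqNorm (ψ i - ψ j) := by
      rw [eq_sub_of_add_eq hp2]; ring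
    have h7 := mul_le_mul_of_nonneg_left hsm (by positivity : 0 ≤ |E| + 1)
    linarith
  obtain ⟨dg, hgH, hdlim, hnlim⟩ := exists_limit hψ hg hcauchy
  refine ⟨g, dg, hgH, ?_, ?_⟩
  · refine tendsto_nhds_unique hnlim ?_
    simp only [hne1, tendsto_const_nhds_iff]
  · refine tendsto_nhds_unique ?_ hen
    refine hdlim.add (Tendsto.const_mul α (tendsto_finsetSum _ fun y hy => ?_))
    exact ((hg.tendsto_at (Ioo_subset_Icc_self (hY hy))).norm).pow 2

/-! ### The lowest eigenvalue as a minimum. -/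

/-- Passing to the graph replaces the operator by the weak equation on the form domain. -/
theorem mem_eigenvalues_iff {α : ℝ} {Y : Finset ℝ} {l : ℝ} :
    l ∈ eigenvalues α Y ↔ ∃ u : L2, u ≠ 0 ∧ (u, (l : ℂ) • u) ∈ graph α Y := by
  constructor
  · rintro ⟨u, hu, h⟩
    refine ⟨u, hu, ?_⟩
    rw [← hamiltonian_graph, LinearPMap.mem_graph_iff]
    exact ⟨u, rfl, h⟩
  · rintro ⟨u, hu, h⟩
    rw [← hamiltonian_graph, LinearPMap.mem_graph_iff] at h
    obtain ⟨v, hv, hl⟩ := h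
    simp only at hv hl
    subst hv
    exact ⟨v, hu, hl⟩

theorem integral_conj_mul_smul {u : L2} {φ ψ : ℝ → ℂ} (hu : u =ᵐ[loopMeasure] ψ) (c : ℂ) :
    ∫ x in Ioo 0 (2 * Real.pi), conj (φ x) * (c • u : L2) x =
      c * ∫ x in Ioo 0 (2 * Real.pi), conj (φ x) * ψ x := by
  rw [← integral_const_mul]
  refine integral_congr_ae ?_
  filter_upwards [Lp.coeFn_smul c u, hu] with x h1 h2
  rw [h1, Pi.smul_apply, h2, smul_eq_mul]
  ring

/-- The Euler-Lagrange equation of a minimizer. -/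
theorem form_eq_of_minimizer {α E : ℝ} {Y : Finset ℝ}
    (hE : ∀ ψ dψ, IsPeriodicH1 ψ dψ → E * sqNorm ψ ≤ energy α Y ψ dψ) {ψ dψ φ dφ : ℝ → ℂ}
    (h : IsPeriodicH1 ψ dψ) (hψ : energy α Y ψ dψ = E * sqNorm ψ) (k : IsPeriodicH1 φ dφ) :
    form α Y φ dφ ψ dψ = E * ∫ x in Ioo 0 (2 * Real.pi), conj (φ x) * ψ x := by
  rw [← sub_eq_zero]
  set z : ℂ := form α Y φ dφ ψ dψ - E * ∫ x in Ioo 0 (2 * Real.pi), conj (φ x) * ψ x with hz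
  set D : ℝ := energy α Y φ dφ - E * sqNorm φ
  -- Vary the minimizer in the direction `z φ`, where `z` is the defect of the claimed equation;
  -- this makes the linear term `2t‖z‖²`.
  have key : ∀ t : ℝ, 0 ≤ ‖z‖ ^ 2 * (2 * t + t ^ 2 * D) := by
    intro t
    have h1 := hE _ _ (h.add (k.smul (t * z)))
    rw [energy_add_smul α Y h k, sqNorm_add_smul h.memLp k.memLp, hψ] at h1
    have h2 : (conj (t * z) * form α Y φ dφ ψ dψ).re -
        E * (conj (t * z) * ∫ x in Ioo 0 (2 * Real.pi), conj (φ x) * ψ x).re =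
        t * ‖z‖ ^ 2 := by
      rw [← Complex.re_ofReal_mul, ← Complex.sub_re, mul_left_comm, ← mul_sub, ← hz, map_mul,
        Complex.conj_ofReal, mul_assoc, Complex.conj_mul', Complex.re_ofReal_mul,
        ← Complex.ofReal_pow, Complex.ofReal_re]
    have h3 : ‖(t * z : ℂ)‖ ^ 2 = t ^ 2 * ‖z‖ ^ 2 := by
      rw [norm_mul, mul_pow, Complex.norm_real, Real.norm_eq_abs, sq_abs]
    rw [h3] at h1
    have e : ‖z‖ ^ 2 * (2 * t + t ^ 2 * D) =
        2 * (t * ‖z‖ ^ 2) + t ^ 2 * ‖z‖ ^ 2 * D := by ring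
    rw [e, ← h2]
    simp only [D]
    linarith
  by_contra hne
  have hpos : 0 < ‖z‖ ^ 2 := by positivity
  -- A small negative `t` makes the linear term dominate; `1/(|D| + 1)` is small enough.
  have h1 := nonneg_of_mul_nonneg_right (key (-(1 / (|D| + 1)))) hpos
  have hD : D ≤ |D| := le_abs_self D
  have hd : 0 < |D| + 1 := by positivity
  have e : 2 * -(1 / (|D| + 1)) + (-(1 / (|D| + 1))) ^ 2 * D =
      (D - 2 * (|D| + 1)) / (|D| + 1) ^ 2 := by
    field_simp
    ring
  rw [e] at h1
  have : (D - 2 * (|D| + 1)) / (|D| + 1) ^ 2 < 0 :=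
    div_neg_of_neg_of_pos (by linarith [abs_nonneg D]) (by positivity)
  linarith

/-- For weak coupling, the lowest eigenvalue exists and is the minimum of the quotient of the form
by the squared norm. -/
theorem groundEnergy_spec {α : ℝ} {Y : Finset ℝ} (hY : (Y : Set ℝ) ⊆ Ioo 0 (2 * Real.pi))
    (hα : |α| * (Y.card * (8 * Real.pi)) ≤ 1) :
    IsLeast (eigenvalues α Y) (groundEnergy α Y) ∧
      (∀ ψ dψ, IsPeriodicH1 ψ dψ → groundEnergy α Y * sqNorm ψ ≤ energy α Y ψ dψ) ∧
      ∃ ψ dψ, IsPeriodicH1 ψ dψ ∧ sqNorm ψ = 1 ∧ energy α Y ψ dψ = groundEnergy α Y := by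
  obtain ⟨E, hE, ψ, dψ, h, h1, hψ⟩ := exists_minimizer hY hα
  have hleast : IsLeast (eigenvalues α Y) E := by
    constructor
    · refine mem_eigenvalues_iff.2 ⟨h.memLp.toLp ψ, ?_, ψ, dψ, h, h.memLp.coeFn_toLp,
        fun φ dφ k => ?_⟩
      · intro h0
        have := norm_toLp_sq h.memLp
        rw [h0, h1] at this
        simp at this
      · rw [integral_conj_mul_smul h.memLp.coeFn_toLp,
          form_eq_of_minimizer hE h (by rw [h1, hψ, mul_one]) k]
    -- Testing the eigenvalue equation against the eigenfunction itself shows that every eigenvalue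
    -- is a Rayleigh quotient.
    · intro l hl
      obtain ⟨u, hu, χ, dχ, k, huχ, hform⟩ := mem_eigenvalues_iff.1 hl
      have h2 := hform χ dχ k
      rw [integral_conj_mul_smul huχ, form_self, integral_conj_mul_self] at h2
      have h3 : energy α Y χ dχ = l * sqNorm χ := by exact_mod_cast h2
      have h4 : 0 < sqNorm χ := by
        rw [← norm_toLp_sq k.memLp]
        have : k.memLp.toLp χ = u := Lp.ext (k.memLp.coeFn_toLp.trans huχ.symm)
        rw [this]
        have := norm_pos_iff.2 hu
        positivity
      have h5 := hE χ dχ k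
      rw [h3] at h5
      exact le_of_mul_le_mul_right h5 h4
  have e : groundEnergy α Y = E := hleast.csInf_eq
  rw [e]
  exact ⟨hleast, hE, ψ, dψ, h, h1, hψ⟩

theorem IsPeriodicH1.integral_eq {ψ dψ : ℝ → ℂ} (h : IsPeriodicH1 ψ dψ) (l : ℝ) :
    ∫ x in (0 : ℝ)..(2 * Real.pi), (‖dψ x‖ ^ 2 - l * ‖ψ x‖ ^ 2) =
      sqNorm dψ - l * sqNorm ψ := by
  rw [intervalIntegral.integral_of_le (by positivity), integral_Ioc_eq_integral_Ioo,
    integral_sub (integrable_norm_sq h.memLp_deriv) ((integrable_norm_sq h.memLp).const_mul l),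
    integral_const_mul]
  rfl

/-! ### Comparing ground energies with the profile parameter. -/

section

variable {N : ℕ} {p : ℕ → ℝ} {Y : Finset ℝ} {α l : ℝ} {C T : ℝ → ℝ}

theorem Chain.card_eq (hp : Chain N p Y) : Y.card = N := by
  rw [Finset.card_eq_sum_ones, hp.sum_eq fun _ => 1, Finset.sum_const, Finset.card_range,
    smul_eq_mul, mul_one]

theorem Chain.subset_Ioo (hp : Chain N p Y) : (Y : Set ℝ) ⊆ Ioo 0 (2 * Real.pi) := by
  intro y hy
  rw [← hp.image_eq, Finset.coe_image] at hy
  obtain ⟨j, hj, rfl⟩ := hy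
  exact hp.mem_Ioo j hj

/-- A lower bound for the form when all gaps are equal. -/
theorem Chain.le_energy (hp : Chain N p Y) (hN : 1 ≤ N) (hT : Profile l C T)
    (hα : 2 * T (Real.pi / N) = α) (heq : ∀ j < N, half p j = Real.pi / N) {ψ dψ : ℝ → ℂ}
    (h : IsPeriodicH1 ψ dψ) : l * sqNorm ψ ≤ energy α Y ψ dψ := by
  have heq' : ∀ j ≤ N, half p j = Real.pi / N := fun j hj => by
    rcases hj.eq_or_lt with rfl | hj
    · rw [hp.half_last, heq 0 hN]
    · exact heq j hj
  have h1 := hp.energy_eq hN hT h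
  rw [h.integral_eq] at h1
  have h2 : ∑ j ∈ Finset.range N, (T (half p j) + T (half p (j + 1))) * ‖ψ (p (j + 1))‖ ^ 2 =
      α * ∑ y ∈ Y, ‖ψ y‖ ^ 2 := by
    rw [hp.sum_eq, Finset.mul_sum]
    refine Finset.sum_congr rfl fun j hj => ?_
    rw [heq' j (Finset.mem_range.1 hj).le, heq' (j + 1) (Finset.mem_range.1 hj), ← hα]
    ring
  have h3 : 0 ≤ ∑ j ∈ Finset.range (N + 1), ∫ x in knot p j..knot p (j + 1),
      ‖dψ x - (-T (x - mid p j)) • ψ x‖ ^ 2 :=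
    Finset.sum_nonneg fun j hj => intervalIntegral.integral_nonneg
      (hp.knot_mono (Nat.lt_succ_iff.1 (Finset.mem_range.1 hj))) fun _ _ => by positivity
  rw [h2] at h1
  rw [energy]
  linarith

/-- The energy of the test function. -/
theorem Chain.exists_test (hp : Chain N p Y) (hN : 1 ≤ N) (hT : Profile l C T) :
    ∃ ψ dψ, IsPeriodicH1 ψ dψ ∧ 0 < sqNorm ψ ∧ energy α Y ψ dψ =
      l * sqNorm ψ + (α * N - 2 * ∑ j ∈ Finset.range N, T (half p j)) := by
  have h := hp.isPeriodicH1_testFun hN hT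
  refine ⟨_, _, h, ?_, ?_⟩
  · rw [sqNorm, setIntegral_pos_iff_support_of_nonneg_ae (.of_forall fun _ => by positivity)
      (integrable_norm_sq h.memLp)]
    have hs : Ioo 0 (2 * Real.pi) ⊆ Function.support
        (fun x => ‖(testFun C N p x : ℂ)‖ ^ 2) ∩ Ioo 0 (2 * Real.pi) := by
      refine fun x hx => ⟨?_, hx⟩
      obtain ⟨j, hj, hxj⟩ := hp.exists_gap hN (Ioo_subset_Icc_self hx)
      have hxj' := Ico_subset_Icc_self hxj
      have : 0 < testFun C N p x := by
        rw [hp.testFun_eq hN hT hj hxj']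
        exact div_pos (hT.pos _ (hp.sub_mid_mem hN hj hxj')) (hT.pos _ (hp.half_mem hN hj))
      simp [this.ne']
    refine lt_of_lt_of_le ?_ (measure_mono hs)
    simp [Real.pi_pos]
  · have h1 := hp.energy_testFun hN hT
    rw [h.integral_eq l] at h1
    have h2 : ∑ y ∈ Y, ‖(testFun C N p y : ℂ)‖ ^ 2 = N := by
      rw [hp.sum_eq (fun y => ‖(testFun C N p y : ℂ)‖ ^ 2), Finset.sum_congr rfl fun j hj => by
        rw [hp.testFun_point hN hT (Finset.mem_range.1 hj)]]
      simp
    rw [energy, h2]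
    linarith

/-- The matching condition turns `αN` into `2N T(π/N)`, so by Jensen the trial function has excess
at most zero. -/
theorem Chain.groundEnergy_le (hp : Chain N p Y) (hN : 1 ≤ N) (hT : Profile l C T)
    (hα : 2 * T (Real.pi / N) = α) (hconv : ConvexOn ℝ (Icc 0 Real.pi) T)
    (hsmall : |α| * (N * (8 * Real.pi)) ≤ 1) : groundEnergy α Y ≤ l := by
  obtain ⟨-, hE, -⟩ := groundEnergy_spec hp.subset_Ioo (by rwa [hp.card_eq])
  obtain ⟨ψ, dψ, h, h0, he⟩ := hp.exists_test (α := α) hN hT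
  have h1 := hE ψ dψ h
  have h2 := hp.le_sum_half hN hconv
  refine le_of_mul_le_mul_right ?_ h0
  have e : α * N = 2 * (N * T (Real.pi / N)) := by rw [← hα]; ring
  rw [he] at h1
  linarith

theorem Chain.groundEnergy_lt (hp : Chain N p Y) (hN : 1 ≤ N) (hT : Profile l C T)
    (hα : 2 * T (Real.pi / N) = α) (hconv : StrictConvexOn ℝ (Icc 0 Real.pi) T)
    (hsmall : |α| * (N * (8 * Real.pi)) ≤ 1) (hne : ∃ j < N, half p j ≠ Real.pi / N) :
    groundEnergy α Y < l := by
  obtain ⟨-, hE, -⟩ := groundEnergy_spec hp.subset_Ioo (by rwa [hp.card_eq])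
  obtain ⟨ψ, dψ, h, h0, he⟩ := hp.exists_test (α := α) hN hT
  have h1 := hE ψ dψ h
  have h2 := hp.lt_sum_half hN hconv hne
  refine lt_of_mul_lt_mul_right ?_ h0.le
  have e : α * N = 2 * (N * T (Real.pi / N)) := by rw [← hα]; ring
  rw [he] at h1
  linarith

/-- The trial function gives the upper bound; the completed square, applied to a normalized
minimizer, gives the lower one. -/
theorem Chain.groundEnergy_eq (hp : Chain N p Y) (hN : 1 ≤ N) (hT : Profile l C T)
    (hα : 2 * T (Real.pi / N) = α) (hconv : ConvexOn ℝ (Icc 0 Real.pi) T)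
    (hsmall : |α| * (N * (8 * Real.pi)) ≤ 1) (heq : ∀ j < N, half p j = Real.pi / N) :
    groundEnergy α Y = l := by
  refine le_antisymm (hp.groundEnergy_le hN hT hα hconv hsmall) ?_
  obtain ⟨-, -, ψ, dψ, h, h1, he⟩ := groundEnergy_spec hp.subset_Ioo (by rwa [hp.card_eq])
  have := hp.le_energy hN hT hα heq h
  rwa [h1, he, mul_one] at this

end

end LoopDelta

end

theorem mainTheorem4 (N : ℕ) (hN : 2 ≤ N) :
    ∃ α₀ : ℝ, 0 < α₀ ∧ ∀ α : ℝ, |α| < α₀ →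
      ∀ Y : Finset ℝ, (Y : Set ℝ) ⊆ Set.Ioo 0 (2 * Real.pi) → Y.card = N →
        IsLeast (LoopDelta.eigenvalues α Y) (LoopDelta.groundEnergy α Y) ∧
        IsLeast (LoopDelta.eigenvalues α (LoopDelta.equidistant N))
          (LoopDelta.groundEnergy α (LoopDelta.equidistant N)) ∧
        LoopDelta.groundEnergy α Y ≤ LoopDelta.groundEnergy α (LoopDelta.equidistant N) ∧
        (α ≠ 0 →
          (LoopDelta.groundEnergy α Y < LoopDelta.groundEnergy α (LoopDelta.equidistant N) ↔
            ¬ LoopDelta.Congruent Y (LoopDelta.equidistant N))) := by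
  have hN1 : 1 ≤ N := by omega
  have hN2 : (2 : ℝ) ≤ N := by exact_mod_cast hN
  have hpi := Real.pi_pos
  have htan : 0 < Real.tan (Real.pi / (2 * N)) :=
    Real.tan_pos_of_pos_of_lt_pi_div_two (by positivity) (by gcongr; linarith)
  have htanh : 0 < 2 * Real.tanh (Real.pi / N) := by
    have := LoopDelta.tanh_strictMono (show 0 < Real.pi / N by positivity)
    rw [Real.tanh_zero] at this
    linarith
  -- The first two bounds provide the profile for each sign of α; the third makes the form coercive.
  refine ⟨min (min (Real.tan (Real.pi / (2 * N))) (2 * Real.tanh (Real.pi / N)))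
    (1 / (N * (8 * Real.pi))), by positivity, fun α hα Y hY hc => ?_⟩
  rw [lt_min_iff, lt_min_iff] at hα
  obtain ⟨⟨hα1, hα2⟩, hα3⟩ := hα
  have hsmall : |α| * (N * (8 * Real.pi)) ≤ 1 := ((lt_div_iff₀ (by positivity)).1 hα3).le
  obtain ⟨l, C, T, hT, hTα, hconv, hstrict⟩ := LoopDelta.exists_profile hN hα1 hα2
  obtain ⟨p, hp⟩ := LoopDelta.exists_chain hN1 hY hc
  have hq := LoopDelta.chain_equidistant hN1
  have heq := hq.groundEnergy_eq hN1 hT hTα hconv hsmall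
    fun j _ => LoopDelta.half_equidistant N j
  refine ⟨(LoopDelta.groundEnergy_spec hY (by rwa [hc])).1,
    (LoopDelta.groundEnergy_spec hq.subset_Ioo (by rwa [hq.card_eq])).1, ?_, fun h0 => ⟨?_, ?_⟩⟩
  · rw [heq]
    exact hp.groundEnergy_le hN1 hT hTα hconv hsmall
  · intro hlt hcong
    rw [heq, hp.groundEnergy_eq hN1 hT hTα hconv hsmall (hp.half_of_congruent hN hcong)] at hlt
    exact lt_irrefl _ hlt
  · intro hncong
    rw [heq]
    refine hp.groundEnergy_lt hN1 hT hTα (hstrict h0) hsmall ?_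
    by_contra! hall
    exact hncong (hp.congruent_of_half hN1 hall)
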